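/- Let $z,z'\in\mathbb C$ be such that for every $k=1,2,\dots$ the numbers $(z)_k(z')_k$ and $(-z)_k(-z')_k$ are real and strictly positive, where $(a)_k=a(a+1)\cdots(a+k-1)$; put $t=zz'>0$. All fractional powers below are of positive numbers and are positive. Let $F(a,b;c;w)$ be the Gauss hypergeometric function (for $w\in\mathbb C\setminus[1,\infty)$, the analytic continuation of the Gauss series along the segment from $0$ to $w$). For $0<\xi<1$ and real $u\ge 0$ (and near such points) put $$\psi_\pm(u)=t^{1/2}\xi^{u+1/2}(1-\xi)^{\pm(z+z')}\frac{\Gamma(u+1\pm z)\Gamma(u+1\pm z')}{\Gamma(1\pm z)\Gamma(1\pm z')\Gamma(u+1)\Gamma(u+1)},$$ $$R_\pm(u)=\psi_\pm(u)\,F\!\left(\mp z,\mp z';u+1;\tfrac{\xi}{\xi-1}\right),\qquad S_\pm(u)=\frac{t^{1/2}\xi^{1/2}\psi_\pm(u)}{1-\xi}\cdot\frac{F\!\left(1\mp z,1\mp z';u+2;\tfrac{\xi}{\xi-1}\right)}{u+1},$$ $$P_\pm(u)=\psi_\pm(u)^{-1/2}R_\pm(u),\qquad Q_\pm(u)=\psi_\pm(u)^{-1/2}S_\pm(u).$$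 The blocks of the hypergeometric kernel are, for $k,l\in\{0,1,2,\dots\}$, $$K_{++}(k,l)=\frac{P_+(k)Q_+(l)-Q_+(k)P_+(l)}{k-l},\qquad K_{+-}(k,l)=\frac{P_+(k)P_-(l)+Q_+(k)Q_-(l)}{k+l+1},$$ $$K_{-+}(k,l)=-\frac{P_-(k)P_+(l)+Q_-(k)Q_+(l)}{k+l+1},\qquad K_{--}(k,l)=\frac{P_-(k)Q_-(l)-Q_-(k)P_-(l)}{k-l},$$ where for $k=l$ the blocks $K_{++},K_{--}$ are understood by L'Hospital's rule, i.e. $K_{\pm\pm}(k,k)=P_\pm'(k)Q_\pm(k)-Q_\pm'(k)P_\pm(k)$. Let $W_{\kappa,\mu}(x)$, $x>0$, be the Whittaker function, i.e. the unique solution on $(0,\infty)$ of $y''-\left(\frac14-\frac{\kappa}{x}+\frac{\mu^2-\frac14}{x^2}\right)y=0$ with $y(x)\sim x^{\kappa}e^{-x/2}$ as $x\to+\infty$. For $x>0$ put $$\mathcal P_\pm(x)=\frac{(zz')^{1/4}}{(\Gamma(1\pm z)\Gamma(1\pm z')x)^{1/2}}\,W_{\frac{\pm(z+z')+1}{2},\frac{z-z'}{2}}(x),\qquad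 \mathcal Q_\pm(x)=\frac{(zz')^{3/4}}{(\Gamma(1\pm z)\Gamma(1\pm z')x)^{1/2}}\,W_{\frac{\pm(z+z')-1}{2},\frac{z-z'}{2}}(x).$$ The blocks of the (matrix) Whittaker kernel are, for $x,y>0$, $$\mathcal K_{++}(x,y)=\frac{\mathcal P_+(x)\mathcal Q_+(y)-\mathcal Q_+(x)\mathcal P_+(y)}{x-y},\qquad \mathcal K_{+-}(x,y)=\frac{\mathcal P_+(x)\mathcal P_-(y)+\mathcal Q_+(x)\mathcal Q_-(y)}{x+y},$$ $$\mathcal K_{-+}(x,y)=-\frac{\mathcal P_-(x)\mathcal P_+(y)+\mathcal Q_-(x)\mathcal Q_+(y)}{x+y},\qquad \mathcal K_{--}(x,y)=\frac{\mathcal P_-(x)\mathcal Q_-(y)-\mathcal Q_-(x)\mathcal P_-(y)}{x-y},$$ again with L'Hospital's rule for $x=y$ in $\mathcal K_{++}$ and $\mathcal K_{--}$. Theorem 5.4. For all $u,v>0$ and each of the four blocks $**\in\{++,+-,-+,--\}$, $$\lim_{\xi\nearrow1}\frac1{1-\xi}\,K_{**}\!\left(\left[\frac u{1-\xi}\right],\left[\frac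 v{1-\xi}\right]\right)=\mathcal K_{**}(u,v),$$ where $[\cdot]$ denotes the integer part. -/

import Mathlib

open Filter Topology Asymptotics

noncomputable section

/-- The two signs `+` and `-`, used as indices of functions and of kernel blocks. -/
inductive PM : Type
  | plus : PM
  | minus : PM

/-- The number `+1` or `-1`. -/
def PM.val : PM → ℂ
  | PM.plus => 1
  | PM.minus => -1

/-- Standing assumption on the parameters: for every `k ≥ 1` the numbers `(z)_k (z')_k` and
`(-z)_k (-z')_k` are real and strictly positive, where `(a)_k = a (a+1) ⋯ (a+k-1)`. -/
def Admissible (z z' : ℂ) : Prop :=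
  ∀ k : ℕ, 1 ≤ k →
    (∃ r : ℝ, 0 < r ∧ (ascPochhammer ℂ k).eval z * (ascPochhammer ℂ k).eval z' = (r : ℂ)) ∧
    (∃ r : ℝ, 0 < r ∧ (ascPochhammer ℂ k).eval (-z) * (ascPochhammer ℂ k).eval (-z') = (r : ℂ))

/-- `y` is the value at `w` of the analytic continuation of the Gauss series
`∑ (a)_n (b)_n / ((c)_n n!) wⁿ` from a neighbourhood of `0` to `w` along the straight segment:
some analytic function on an open set that contains `w` and is star-shaped about `0` agrees with
the Gauss series near `0` and takes the value `y` at `w`. -/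
def IsGaussValue (a b c w y : ℂ) : Prop :=
  ∃ (U : Set ℂ) (f : ℂ → ℂ), IsOpen U ∧ StarConvex ℝ 0 U ∧ w ∈ U ∧ AnalyticOnNhd ℂ f U ∧
    f =ᶠ[𝓝 0] ordinaryHypergeometric a b c ∧ f w = y

/-- The continuation is unique. -/
theorem IsGaussValue.unique {a b c w y₁ y₂ : ℂ} (h₁ : IsGaussValue a b c w y₁)
    (h₂ : IsGaussValue a b c w y₂) : y₁ = y₂ := by
  obtain ⟨U, f, hU, sU, wU, aU, eU, rfl⟩ := h₁
  obtain ⟨V, g, hV, sV, wV, aV, eV, rfl⟩ := h₂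
  have s : StarConvex ℝ 0 (U ∩ V) := sU.inter sV
  have hw : w ∈ U ∩ V := ⟨wU, wV⟩
  have h0 : (0 : ℂ) ∈ U ∩ V := s.mem ⟨w, hw⟩
  exact (aU.mono Set.inter_subset_left).eqOn_of_preconnected_of_eventuallyEq
    (aV.mono Set.inter_subset_right) (s.isPathConnected h0).isConnected.isPreconnected h0
    (eU.trans eV.symm) hw

open Classical in
/-- The Gauss hypergeometric function `F(a, b; c; w)`, principal branch on `ℂ ∖ [1, ∞)`. -/
def gaussF (a b c w : ℂ) : ℂ :=
  if h : ∃ y, IsGaussValue a b c w y then h.choose else 0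

/-- `gaussF` is the value of the continuation wherever the latter exists. -/
theorem IsGaussValue.gaussF_eq {a b c w y : ℂ} (h : IsGaussValue a b c w y) :
    gaussF a b c w = y := by
  have h' : ∃ y, IsGaussValue a b c w y := ⟨y, h⟩
  rw [gaussF, dif_pos h']
  exact h'.choose_spec.unique h

/-- `y` solves the Whittaker equation `y'' - (1/4 - κ/x + (μ² - 1/4)/x²) y = 0` on `(0, ∞)` and
`y(x) ~ x^κ e^{-x/2}` as `x → +∞`. -/
def IsWhittaker (κ μ : ℂ) (y : ℝ → ℂ) : Prop :=
  (∃ y' : ℝ → ℂ, ∀ x : ℝ, 0 < x →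
    HasDerivAt y (y' x) x ∧
    HasDerivAt y' ((1 / 4 - κ / (x : ℂ) + (μ ^ 2 - 1 / 4) / (x : ℂ) ^ 2) * y x) x) ∧
  y ~[atTop] fun x : ℝ => (x : ℂ) ^ κ * Complex.exp (-(x : ℂ) / 2)

open Classical in
/-- The Whittaker function `W_{κ,μ}(x)`, `x > 0`: the solution of the Whittaker equation with
`W_{κ,μ}(x) ~ x^κ e^{-x/2}` as `x → +∞`. -/
def whittakerW (κ μ : ℂ) : ℝ → ℂ :=
  if h : ∃ y, IsWhittaker κ μ y then h.choose else 0

/-- The function `ψ_±(u)` (with `t = z z'`). -/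
def hypPsi (z z' : ℂ) (ξ : ℝ) (σ : PM) (u : ℝ) : ℂ :=
  (z * z') ^ (1 / 2 : ℂ) * (ξ : ℂ) ^ ((u : ℂ) + 1 / 2) *
    (1 - (ξ : ℂ)) ^ (σ.val * (z + z')) *
    (Complex.Gamma ((u : ℂ) + 1 + σ.val * z) * Complex.Gamma ((u : ℂ) + 1 + σ.val * z')) /
    (Complex.Gamma (1 + σ.val * z) * Complex.Gamma (1 + σ.val * z') *
      Complex.Gamma ((u : ℂ) + 1) * Complex.Gamma ((u : ℂ) + 1))

/-- The function `R_±(u) = ψ_±(u) F(∓z, ∓z'; u+1; ξ/(ξ-1))`. -/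
def hypR (z z' : ℂ) (ξ : ℝ) (σ : PM) (u : ℝ) : ℂ :=
  hypPsi z z' ξ σ u *
    gaussF (-(σ.val * z)) (-(σ.val * z')) ((u : ℂ) + 1) ((ξ : ℂ) / ((ξ : ℂ) - 1))

/-- The function `S_±(u) = t^{1/2} ξ^{1/2} ψ_±(u) / (1-ξ) ⬝ F(1∓z, 1∓z'; u+2; ξ/(ξ-1)) / (u+1)`. -/
def hypS (z z' : ℂ) (ξ : ℝ) (σ : PM) (u : ℝ) : ℂ :=
  (z * z') ^ (1 / 2 : ℂ) * (ξ : ℂ) ^ (1 / 2 : ℂ) * hypPsi z z' ξ σ u / (1 - (ξ : ℂ)) *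
    (gaussF (1 - σ.val * z) (1 - σ.val * z') ((u : ℂ) + 2) ((ξ : ℂ) / ((ξ : ℂ) - 1)) /
      ((u : ℂ) + 1))

/-- The function `P_±(u) = ψ_±(u)^{-1/2} R_±(u)`. -/
def hypP (z z' : ℂ) (ξ : ℝ) (σ : PM) (u : ℝ) : ℂ :=
  hypPsi z z' ξ σ u ^ (-1 / 2 : ℂ) * hypR z z' ξ σ u

/-- The function `Q_±(u) = ψ_±(u)^{-1/2} S_±(u)`. -/
def hypQ (z z' : ℂ) (ξ : ℝ) (σ : PM) (u : ℝ) : ℂ :=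
  hypPsi z z' ξ σ u ^ (-1 / 2 : ℂ) * hypS z z' ξ σ u

open Classical in
/-- The expression `(P(x) Q(y) - Q(x) P(y)) / (x - y)`; for `x = y` it is understood according to
the L'Hospital rule, that is, as `P'(x) Q(x) - Q'(x) P(x)`. -/
def wronskianQuot (P Q : ℝ → ℂ) (x y : ℝ) : ℂ :=
  if x = y then deriv P x * Q x - deriv Q x * P x
  else (P x * Q y - Q x * P y) / ((x : ℂ) - (y : ℂ))

/-- The blocks `K_{στ}(k, l)` of the hypergeometric kernel, `k, l = 0, 1, 2, …`. -/
def hypergeometricKernel (z z' : ℂ) (ξ : ℝ) : PM → PM → ℕ → ℕ → ℂ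
  | PM.plus, PM.plus, k, l =>
      wronskianQuot (hypP z z' ξ PM.plus) (hypQ z z' ξ PM.plus) k l
  | PM.plus, PM.minus, k, l =>
      (hypP z z' ξ PM.plus k * hypP z z' ξ PM.minus l +
        hypQ z z' ξ PM.plus k * hypQ z z' ξ PM.minus l) / ((k : ℂ) + (l : ℂ) + 1)
  | PM.minus, PM.plus, k, l =>
      -((hypP z z' ξ PM.minus k * hypP z z' ξ PM.plus l +
        hypQ z z' ξ PM.minus k * hypQ z z' ξ PM.plus l) / ((k : ℂ) + (l : ℂ) + 1))
  | PM.minus, PM.minus, k, l =>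
      wronskianQuot (hypP z z' ξ PM.minus) (hypQ z z' ξ PM.minus) k l

/-- The function `𝒫_±(x)` that enters the Whittaker kernel. -/
def calP (z z' : ℂ) (σ : PM) (x : ℝ) : ℂ :=
  (z * z') ^ (1 / 4 : ℂ) /
      (Complex.Gamma (1 + σ.val * z) * Complex.Gamma (1 + σ.val * z') * (x : ℂ)) ^ (1 / 2 : ℂ) *
    whittakerW ((σ.val * (z + z') + 1) / 2) ((z - z') / 2) x

/-- The function `𝒬_±(x)` that enters the Whittaker kernel. -/
def calQ (z z' : ℂ) (σ : PM) (x : ℝ) : ℂ :=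
  (z * z') ^ (3 / 4 : ℂ) /
      (Complex.Gamma (1 + σ.val * z) * Complex.Gamma (1 + σ.val * z') * (x : ℂ)) ^ (1 / 2 : ℂ) *
    whittakerW ((σ.val * (z + z') - 1) / 2) ((z - z') / 2) x

/-- The blocks `𝒦_{στ}(x, y)` of the (matrix) Whittaker kernel, `x, y > 0`. -/
def whittakerKernel (z z' : ℂ) : PM → PM → ℝ → ℝ → ℂ
  | PM.plus, PM.plus, x, y => wronskianQuot (calP z z' PM.plus) (calQ z z' PM.plus) x y
  | PM.plus, PM.minus, x, y =>
      (calP z z' PM.plus x * calP z z' PM.minus y +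
        calQ z z' PM.plus x * calQ z z' PM.minus y) / ((x : ℂ) + (y : ℂ))
  | PM.minus, PM.plus, x, y =>
      -((calP z z' PM.minus x * calP z z' PM.plus y +
        calQ z z' PM.minus x * calQ z z' PM.plus y) / ((x : ℂ) + (y : ℂ)))
  | PM.minus, PM.minus, x, y => wronskianQuot (calP z z' PM.minus) (calQ z z' PM.minus) x y

end

/-! After the substitution `u = x / (1 - ξ)` the functions `P_±`, `Q_±` become functions of `x` that
converge to `𝒫_±`, `𝒬_±`, and the factor `1 / (1 - ξ)` turns `k - l` and `k + l + 1` into `u - v`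
and `u + v` in the limit. On the diagonal derivatives must converge as well. For this `x` is allowed
to be complex: joint convergence in `(ξ, x)` of holomorphic functions is locally uniform, so it
passes to derivatives, and it also absorbs the rounding error of the integer part.

The core is the limit of `F(a, b; x/(1-ξ) + d; ξ/(ξ-1))`. For `re b > 0`, Euler's integral with `t =
(1-ξ)s` tends by dominated convergence to the Laplace integral `∫ s^(b-1) e^(-xs) (1+s)^(-a) ds`
(`tendsto_scaledIntegral`). Its case `a = 0` is a beta integral and yields the asymptotics of Gamma
quotients, hence the limit of `ψ_±`. Since `b` is `∓z'` or `1 ∓ z'`, its real part has no sign; a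
contiguous relation in `b`, which survives the limit, carries everything down to arbitrary `b`
(`GaussLimit.sub_one`, `exists_gaussLimitPair`).

The limits for `b` and `b + 1` satisfy a first-order linear system and tend to `1` at infinity, so
`x^κ e^(-x/2)` times the first one is a Whittaker function (`GaussLimitPair.isWhittaker`), the only
one by a Wronskian argument (`IsWhittaker.eqOn`). Admissibility makes `zz'`, `Γ(1±z)Γ(1±z')`
positive and `z + z'` real, so the limit of `ψ_±` is positive and its fractional powers behave as
for real numbers. -/

/-! ### Locally uniform limits of holomorphic functions -/

/-- The functions `φ i` converge to `g` along `l`, jointly with the argument, at all points near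
`x₀`, and they are holomorphic near `x₀`. -/
def HolLim {ι : Type*} (l : Filter ι) (φ : ι → ℂ → ℂ) (g : ℂ → ℂ) (x₀ : ℂ) : Prop :=
  (∀ᶠ p : ι × ℂ in l ×ˢ 𝓝 x₀, DifferentiableAt ℂ (φ p.1) p.2) ∧
    ∀ᶠ x in 𝓝 x₀, Tendsto (fun p : ι × ℂ => φ p.1 p.2) (l ×ˢ 𝓝 x) (𝓝 (g x))

namespace HolLim

variable {ι : Type*} {l : Filter ι} {φ χ : ι → ℂ → ℂ} {g h : ℂ → ℂ} {x₀ : ℂ}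

theorem tendsto (H : HolLim l φ g x₀) :
    Tendsto (fun p : ι × ℂ => φ p.1 p.2) (l ×ˢ 𝓝 x₀) (𝓝 (g x₀)) :=
  H.2.self_of_nhds

theorem eventually_nhds_prod {p : ι × ℂ → Prop} (H : ∀ᶠ q in l ×ˢ 𝓝 x₀, p q) :
    ∀ᶠ q : ι × ℂ in l ×ˢ 𝓝 x₀, ∀ᶠ y in 𝓝 q.2, p (q.1, y) := by
  obtain ⟨A, hA, B, hB, h⟩ := eventually_prod_iff.1 H
  exact eventually_prod_iff.2 ⟨A, hA, _, hB.eventually_nhds, fun hx _ hy => hy.mono fun z hz => h hx hz⟩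

theorem congr (H : HolLim l φ g x₀) (h₁ : ∀ᶠ p : ι × ℂ in l ×ˢ 𝓝 x₀, χ p.1 p.2 = φ p.1 p.2)
    (h₂ : g =ᶠ[𝓝 x₀] h) : HolLim l χ h x₀ := by
  have h₁' := eventually_nhds_prod h₁
  refine ⟨?_, ?_⟩
  · filter_upwards [H.1, h₁'] with p hp hq
    exact hp.congr_of_eventuallyEq hq
  · obtain ⟨A, hA, B, hB, hAB⟩ := eventually_prod_iff.1 h₁
    filter_upwards [H.2, h₂, hB.eventually_nhds] with x hx hx2 hx3
    rw [← hx2]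
    refine hx.congr' ?_
    filter_upwards [prod_mem_prod hA hx3] with p hp
    exact (hAB hp.1 hp.2).symm

theorem param {α : ι → ℂ} {A : ℂ} (H : Tendsto α l (𝓝 A)) :
    HolLim l (fun i _ => α i) (fun _ => A) x₀ :=
  ⟨.of_forall fun _ => differentiableAt_const _, .of_forall fun _ => H.comp tendsto_fst⟩

theorem fixed {f : ℂ → ℂ} (H : ∀ᶠ x in 𝓝 x₀, DifferentiableAt ℂ f x) :
    HolLim l (fun _ => f) f x₀ :=
  ⟨H.prod_inr l, H.mono fun _ hx => hx.continuousAt.tendsto.comp tendsto_snd⟩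

theorem add (H : HolLim l φ g x₀) (K : HolLim l χ h x₀) :
    HolLim l (fun i x => φ i x + χ i x) (fun x => g x + h x) x₀ :=
  ⟨(H.1.and K.1).mono fun _ hp => hp.1.add hp.2, (H.2.and K.2).mono fun _ hp => hp.1.add hp.2⟩

theorem mul (H : HolLim l φ g x₀) (K : HolLim l χ h x₀) :
    HolLim l (fun i x => φ i x * χ i x) (fun x => g x * h x) x₀ :=
  ⟨(H.1.and K.1).mono fun _ hp => hp.1.mul hp.2, (H.2.and K.2).mono fun _ hp => hp.1.mul hp.2⟩

/-- Fixing `x` near `x₀` and letting only the index run, `g x` is a limit of values lying in a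
closed neighbourhood of `g x₀`. -/
theorem continuousAt [l.NeBot] (H : HolLim l φ g x₀) : ContinuousAt g x₀ := by
  refine (closed_nhds_basis (g x₀)).tendsto_right_iff.2 fun V ⟨hV, hVc⟩ => ?_
  obtain ⟨A, hA, B, hB, hAB⟩ := eventually_prod_iff.1 (H.tendsto.eventually hV)
  filter_upwards [hB, H.2] with x hx hx2
  have : Tendsto (fun i => φ i x) l (𝓝 (g x)) :=
    hx2.comp (tendsto_id.prodMk tendsto_const_nhds)
  exact hVc.mem_of_tendsto this (hA.mono fun i hi => hAB hi hx)

theorem comp [l.NeBot] (H : HolLim l φ g x₀) {f : ℂ → ℂ}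
    (hf : ∀ᶠ y in 𝓝 (g x₀), DifferentiableAt ℂ f y) :
    HolLim l (fun i x => f (φ i x)) (fun x => f (g x)) x₀ := by
  refine ⟨?_, ?_⟩
  · filter_upwards [H.1, H.tendsto.eventually hf] with p hp hp2
    exact hp2.comp p.2 hp
  · filter_upwards [H.2, H.continuousAt.eventually hf] with x hx hx2
    exact hx2.continuousAt.tendsto.comp hx

theorem inv [l.NeBot] (H : HolLim l φ g x₀) (h0 : g x₀ ≠ 0) :
    HolLim l (fun i x => (φ i x)⁻¹) (fun x => (g x)⁻¹) x₀ :=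
  H.comp (f := fun y => y⁻¹) ((eventually_ne_nhds h0).mono fun _ hy => differentiableAt_inv hy)

theorem div [l.NeBot] (H : HolLim l φ g x₀) (K : HolLim l χ h x₀) (h0 : h x₀ ≠ 0) :
    HolLim l (fun i x => φ i x / χ i x) (fun x => g x / h x) x₀ := by
  simpa only [div_eq_mul_inv] using H.mul (K.inv h0)

/-- Joint convergence at every point of an open set, together with continuity of the limit, is
locally uniform convergence. This gives access to Weierstrass' theorem, on which the next two lemmas
rest. -/
theorem exists_isOpen [l.NeBot] (H : HolLim l φ g x₀) :
    ∃ U, IsOpen U ∧ x₀ ∈ U ∧ (∀ᶠ i in l, DifferentiableOn ℂ (φ i) U) ∧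
      TendstoLocallyUniformlyOn φ g l U := by
  obtain ⟨A, hA, B, hB, hAB⟩ := eventually_prod_iff.1 H.1
  obtain ⟨U, hU, hUo, hxU⟩ := eventually_nhds_iff.1 (hB.and H.2)
  refine ⟨U, hUo, hxU, hA.mono fun i hi x hx => (hAB hi (hU x hx).1).differentiableWithinAt, ?_⟩
  rw [hUo.tendstoLocallyUniformlyOn_iff_forall_tendsto]
  intro x hx
  have hHx : HolLim l φ g x := by
    refine ⟨eventually_prod_iff.2 ⟨A, hA, B, ?_, fun a _ b => hAB a b⟩, ?_⟩
    · filter_upwards [hUo.mem_nhds hx] with y hy using (hU y hy).1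
    · filter_upwards [hUo.mem_nhds hx] with y hy using (hU y hy).2
  exact ((hHx.continuousAt.tendsto.comp tendsto_snd).prodMk_nhds hHx.tendsto).mono_right
    (nhds_le_uniformity _)

theorem differentiableAt [l.NeBot] (H : HolLim l φ g x₀) : DifferentiableAt ℂ g x₀ := by
  obtain ⟨U, hU, hx, hd, ht⟩ := H.exists_isOpen
  exact (ht.differentiableOn hd hU).differentiableAt (hU.mem_nhds hx)

theorem tendsto_deriv [l.NeBot] (H : HolLim l φ g x₀) :
    Tendsto (fun p : ι × ℂ => deriv (φ p.1) p.2) (l ×ˢ 𝓝 x₀) (𝓝 (deriv g x₀)) := by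
  obtain ⟨U, hU, hx, hd, ht⟩ := H.exists_isOpen
  have h1 := ht.deriv hd hU
  rw [hU.tendstoLocallyUniformlyOn_iff_forall_tendsto] at h1
  have h2 : ContinuousAt (deriv g) x₀ :=
    (((ht.differentiableOn hd hU).deriv hU).differentiableAt (hU.mem_nhds hx)).continuousAt
  have h3 := h1 x₀ hx
  refine Uniform.tendsto_nhds_right.2 ?_
  have h4 : Tendsto (fun y : ι × ℂ => (deriv g x₀, deriv g y.2)) (l ×ˢ 𝓝 x₀) (uniformity ℂ) :=
    (Uniform.tendsto_nhds_right.1 h2.tendsto).comp tendsto_snd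
  exact h4.uniformity_trans h3

end HolLim

/-! ### Holomorphic dependence of an integral on a parameter -/

open MeasureTheory in
/-- A locally dominated integral of functions which are holomorphic in a parameter is holomorphic
in the parameter. -/
theorem differentiableOn_integral_of_dominated {α : Type*} [MeasurableSpace α] {μ : Measure α}
    {F : ℂ → α → ℂ} {U : Set ℂ} (hU : IsOpen U)
    (hm : ∀ x ∈ U, AEStronglyMeasurable (F x) μ)
    (hd : ∀ᵐ a ∂μ, DifferentiableOn ℂ (fun x => F x a) U)
    (hb : ∀ x₀ ∈ U, ∃ bound : α → ℝ, Integrable bound μ ∧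
      ∃ V ∈ 𝓝 x₀, ∀ᵐ a ∂μ, ∀ x ∈ V, ‖F x a‖ ≤ bound a) :
    DifferentiableOn ℂ (fun x => ∫ a, F x a ∂μ) U := by
  intro x₀ hx₀
  obtain ⟨bound, hbi, V, hV, hbV⟩ := hb x₀ hx₀
  obtain ⟨r, hr, hrV⟩ := Metric.mem_nhds_iff.1 (Filter.inter_mem hV (hU.mem_nhds hx₀))
  have hsub : ∀ x ∈ Metric.ball x₀ (r / 2), Metric.closedBall x (r / 4) ⊆ V ∩ U := by
    intro x hx y hy
    apply hrV
    rw [Metric.mem_ball] at hx ⊢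
    rw [Metric.mem_closedBall] at hy
    linarith [dist_triangle y x x₀]
  have hr2 : 0 < r / 2 := by positivity
  have hder : ∀ a, DifferentiableOn ℂ (fun x => F x a) U → ∀ x ∈ Metric.ball x₀ (r / 2),
      HasDerivAt (fun x => F x a) (deriv (fun x => F x a) x) x := fun a ha x hx =>
    (ha.differentiableAt (hU.mem_nhds
      (hsub x hx (Metric.mem_closedBall_self (by positivity))).2)).hasDerivAt
  -- The derivative is a pointwise limit of difference quotients along a sequence; the shift by `N`
  -- keeps the sequence inside `U`.
  have hmeas : AEStronglyMeasurable (fun a => deriv (fun x => F x a) x₀) μ := by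
    obtain ⟨u, hu⟩ : ∃ u : ℕ → ℂ, Tendsto u atTop (𝓝[≠] x₀) :=
      exists_seq_tendsto (𝓝[≠] x₀)
    have hev : ∀ᶠ n in atTop, u n ∈ U :=
      (hu.mono_right nhdsWithin_le_nhds).eventually (hU.mem_nhds hx₀)
    obtain ⟨N, hN⟩ := eventually_atTop.1 hev
    refine aestronglyMeasurable_of_tendsto_ae (u := atTop)
      (f := fun n a => slope (fun x => F x a) x₀ (u (n + N))) (fun n => ?_) ?_
    · simp only [slope_def_field, div_eq_mul_inv]
      have : AEStronglyMeasurable (fun a => F (u (n + N)) a - F x₀ a) μ :=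
        (hm _ (hN (n + N) (by omega))).sub (hm _ hx₀)
      exact this.mul_const _
    · filter_upwards [hd] with a ha
      have := hasDerivAt_iff_tendsto_slope.1 (hder a ha x₀ (Metric.mem_ball_self hr2))
      exact this.comp (hu.comp (tendsto_add_atTop_nat N))
  -- Cauchy's estimate on circles of radius `r / 4` turns the bound on `F` into a bound on its
  -- derivative; the circles stay in the ball of radius `r` because their centres lie within `r / 2`
  -- of `x₀`.
  have key := hasDerivAt_integral_of_dominated_loc_of_deriv_le (μ := μ) (F := F)
    (F' := fun x a => deriv (fun x => F x a) x) (bound := fun a => bound a / (r / 4))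
    (Metric.ball_mem_nhds x₀ hr2)
    (by filter_upwards [hU.mem_nhds hx₀] with x hx using hm x hx)
    (hbi.mono' (hm x₀ hx₀) (hbV.mono fun a ha => ha x₀ (mem_of_mem_nhds hV)))
    hmeas ?_ (hbi.div_const _) (hd.mono hder)
  · exact key.2.differentiableAt.differentiableWithinAt
  · filter_upwards [hd, hbV] with a ha ha2 x hx
    refine Complex.norm_deriv_le_of_forall_mem_sphere_norm_le (by positivity) ?_
      fun z hz => ha2 z (hsub x hx (Metric.sphere_subset_closedBall hz)).1
    refine DifferentiableOn.diffContOnCl ?_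
    exact ha.mono ((closure_minimal Metric.ball_subset_closedBall
      Metric.isClosed_closedBall).trans fun y hy => (hsub x hx hy).2)

noncomputable section

open MeasureTheory Set

/-! ### The Gauss series and Euler's integral -/

/-- No condition on the parameters is needed: if one of them is a nonpositive integer the radius is
infinite, for `c` because the inverse of `0` is `0` and the coefficients eventually vanish. -/
theorem hasSum_ordinaryHypergeometric (a b c : ℂ) {w : ℂ} (hw : ‖w‖ < 1) :
    HasSum (fun n => ordinaryHypergeometricCoefficient a b c n * w ^ n)
      (ordinaryHypergeometric a b c w) := by
  have hr : 1 ≤ (ordinaryHypergeometricSeries ℂ a b c).radius := by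
    by_cases h : ∀ kn : ℕ, (kn : ℂ) ≠ -a ∧ (kn : ℂ) ≠ -b ∧ (kn : ℂ) ≠ -c
    · rw [ordinaryHypergeometricSeries_radius_eq_one ℂ a b c h]
    · push Not at h
      obtain ⟨k, hk⟩ := h
      by_cases h1 : (k : ℂ) = -a
      · rw [show a = -(k : ℂ) by rw [h1, neg_neg], ordinaryHypergeometric_radius_top_of_neg_nat₁]
        exact le_top
      by_cases h2 : (k : ℂ) = -b
      · rw [show b = -(k : ℂ) by rw [h2, neg_neg], ordinaryHypergeometric_radius_top_of_neg_nat₂]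
        exact le_top
      · rw [show c = -(k : ℂ) by rw [hk h1 h2, neg_neg],
          ordinaryHypergeometric_radius_top_of_neg_nat₃]
        exact le_top
  have h := (ordinaryHypergeometricSeries ℂ a b c).hasSum (x := w) (by
    rw [Metric.mem_eball, edist_zero_right]
    refine lt_of_lt_of_le ?_ hr
    rw [← ofReal_norm]
    exact ENNReal.ofReal_lt_one.2 hw)
  have e : (fun n => ordinaryHypergeometricCoefficient a b c n * w ^ n) =
      fun n => ordinaryHypergeometricSeries ℂ a b c n fun _ => w := by
    funext n
    rw [ordinaryHypergeometricSeries_apply_eq, smul_eq_mul]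
  rw [e]
  exact h

/-- Newton's binomial series, written as `F(a, 1; 1; w)` so that its coefficients compare directly
with those of `F(a, b; c; w)`. -/
theorem hasSum_one_sub_cpow_neg (a : ℂ) {w : ℂ} (hw : ‖w‖ < 1) :
    HasSum (fun n => ordinaryHypergeometricCoefficient a 1 1 n * w ^ n) ((1 - w) ^ (-a)) := by
  have h := (Complex.one_add_cpow_hasFPowerSeriesOnBall_zero (a := -a)).hasSum (y := -w) (by
    rw [Metric.mem_eball, edist_zero_right, enorm_neg, ← ofReal_norm]
    exact ENNReal.ofReal_lt_one.2 hw)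
  rw [zero_add, ← sub_eq_add_neg] at h
  have e : (fun n => ordinaryHypergeometricCoefficient a 1 1 n * w ^ n) =
      fun n => binomialSeries ℂ (-a) n fun _ => -w := by
    funext n
    rw [binomialSeries_eq_ordinaryHypergeometricSeries (b := 1) (by
      intro k hk
      have : ((k + 1 : ℕ) : ℂ) = 0 := by push_cast; rw [hk]; ring
      exact Nat.cast_ne_zero.2 (Nat.succ_ne_zero k) this)]
    have : (fun i : Fin n => (-(ContinuousLinearMap.id ℂ ℂ)) ((fun _ : Fin n => -w) i))
        = fun _ => w := by
      ext; simp
    rw [FormalMultilinearSeries.compContinuousLinearMap_apply]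
    change _ = (ordinaryHypergeometricSeries ℂ (- -a) 1 1 n)
      (fun i : Fin n => (-(ContinuousLinearMap.id ℂ ℂ)) ((fun _ : Fin n => -w) i))
    rw [this, ordinaryHypergeometricSeries_apply_eq, smul_eq_mul, neg_neg]
  rw [e]
  exact h

/-- The integrand of Euler's integral for the Gauss hypergeometric function. -/
def eulerIntegrand (a b c w : ℂ) (t : ℝ) : ℂ :=
  (t : ℂ) ^ (b - 1) * (1 - (t : ℂ)) ^ (c - b - 1) * (1 - w * t) ^ (-a)

/-- Euler's integral for the Gauss hypergeometric function, without the Gamma factors. -/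
def eulerIntegral (a b c w : ℂ) : ℂ := ∫ t in Ioo (0 : ℝ) 1, eulerIntegrand a b c w t

theorem measurable_eulerIntegrand (a b c w : ℂ) : Measurable (eulerIntegrand a b c w) := by
  unfold eulerIntegrand
  fun_prop

theorem one_sub_mul_mem_slitPlane {w : ℂ} {t : ℝ} (hw : w.re < 1) (ht : t ∈ Icc (0 : ℝ) 1) :
    1 - w * t ∈ Complex.slitPlane := by
  left
  have : (1 - w * t).re = 1 - w.re * t := by simp
  rw [this]
  rcases ht.1.eq_or_lt with h | h
  · rw [← h]; norm_num
  · nlinarith [ht.2]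

theorem integrableOn_beta {b e : ℂ} (hb : 0 < b.re) (he : 0 < e.re) :
    IntegrableOn (fun t : ℝ => (t : ℂ) ^ (b - 1) * (1 - (t : ℂ)) ^ (e - 1)) (Ioo 0 1) := by
  have := Complex.betaIntegral_convergent hb he
  rw [intervalIntegrable_iff_integrableOn_Ioo_of_le zero_le_one] at this
  exact this

theorem norm_beta {b e : ℂ} {t : ℝ} (ht : t ∈ Ioo (0 : ℝ) 1) :
    ‖(t : ℂ) ^ b * (1 - (t : ℂ)) ^ e‖ = t ^ b.re * (1 - t) ^ e.re := by
  rw [norm_mul, Complex.norm_cpow_eq_rpow_re_of_pos ht.1, ← Complex.ofReal_one,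
    ← Complex.ofReal_sub, Complex.norm_cpow_eq_rpow_re_of_pos (by linarith [ht.2])]

theorem integrableOn_rpow_beta {p q : ℝ} (hp : 0 < p) (hq : 0 < q) :
    IntegrableOn (fun t : ℝ => t ^ (p - 1) * (1 - t) ^ (q - 1)) (Ioo 0 1) := by
  have h : IntegrableOn (fun t : ℝ => ‖(t : ℂ) ^ ((p : ℂ) - 1) * (1 - (t : ℂ)) ^ ((q : ℂ) - 1)‖)
      (Ioo 0 1) :=
    (integrableOn_beta (b := p) (e := q) (by simpa) (by simpa)).norm
  refine h.congr_fun (fun t ht => ?_) measurableSet_Ioo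
  simp only
  rw [norm_beta ht]
  simp

theorem exists_bound_one_sub_mul_cpow (a : ℂ) {w₀ : ℂ} (hw : w₀.re < 1) :
    ∃ M : ℝ, ∃ V ∈ 𝓝 w₀, ∀ w ∈ V, w.re < 1 ∧ ∀ t ∈ Icc (0 : ℝ) 1,
      ‖(1 - w * t) ^ (-a)‖ ≤ M := by
  have hopen : IsOpen {w : ℂ | w.re < 1} := isOpen_lt Complex.continuous_re continuous_const
  obtain ⟨K, hK, hKsub, hKc⟩ := local_compact_nhds (hopen.mem_nhds hw)
  have hcont : ContinuousOn (fun p : ℂ × ℝ => (1 - p.1 * p.2) ^ (-a)) (K ×ˢ Icc (0 : ℝ) 1) := by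
    refine ContinuousOn.cpow_const (by fun_prop) fun p hp => ?_
    exact one_sub_mul_mem_slitPlane (hKsub hp.1) hp.2
  obtain ⟨M, hM⟩ := (hKc.prod isCompact_Icc).exists_bound_of_continuousOn hcont
  exact ⟨M, K, hK, fun w hw => ⟨hKsub hw, fun t ht => hM (w, t) ⟨hw, ht⟩⟩⟩

theorem differentiableOn_eulerIntegral (a : ℂ) {b c : ℂ} (hb : 0 < b.re) (hc : b.re < c.re) :
    DifferentiableOn ℂ (eulerIntegral a b c) {w | w.re < 1} := by
  refine differentiableOn_integral_of_dominated
    (isOpen_lt Complex.continuous_re continuous_const)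
    (fun w _ => (measurable_eulerIntegrand a b c w).aestronglyMeasurable) ?_ ?_
  · filter_upwards [ae_restrict_mem measurableSet_Ioo] with t ht w hw
    have := one_sub_mul_mem_slitPlane hw (Ioo_subset_Icc_self ht)
    unfold eulerIntegrand
    have h : DifferentiableAt ℂ (fun x : ℂ => 1 - x * t) w := by fun_prop
    exact ((h.cpow_const this).const_mul _).differentiableWithinAt
  · intro w₀ hw₀
    obtain ⟨M, V, hV, hM⟩ := exists_bound_one_sub_mul_cpow a hw₀
    refine ⟨_, ((integrableOn_beta hb (e := c - b) (by simpa using hc)).norm.mul_const M),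
      V, hV, ?_⟩
    filter_upwards [ae_restrict_mem measurableSet_Ioo] with t ht w hw
    rw [eulerIntegrand, norm_mul]
    exact mul_le_mul_of_nonneg_left ((hM w hw).2 t (Ioo_subset_Icc_self ht)) (norm_nonneg _)

theorem differentiableOn_eulerIntegral_param (a : ℂ) {b w : ℂ} (hb : 0 < b.re) (hw : w.re < 1) :
    DifferentiableOn ℂ (fun c => eulerIntegral a b c w) {c | b.re < c.re} := by
  refine differentiableOn_integral_of_dominated
    (isOpen_lt continuous_const Complex.continuous_re)
    (fun c _ => (measurable_eulerIntegrand a b c w).aestronglyMeasurable) ?_ ?_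
  · filter_upwards [ae_restrict_mem measurableSet_Ioo] with t ht c hc
    have : (1 - (t : ℂ)) ≠ 0 := by
      rw [sub_ne_zero]
      exact_mod_cast ht.2.ne'
    unfold eulerIntegrand
    exact (((((differentiableAt_id.sub_const _).sub_const _).const_cpow (Or.inl this)).const_mul
      _).mul_const _).differentiableWithinAt
  · intro c₀ hc₀
    obtain ⟨M, V, hV, hM⟩ := exists_bound_one_sub_mul_cpow a hw
    -- Half of the gap `re c₀ - re b` is kept as the exponent of `1 - t`, so one beta integrand
    -- dominates for all `c` near `c₀`.
    have hη : 0 < (c₀.re - b.re) / 2 := by have : b.re < c₀.re := hc₀; linarith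
    refine ⟨_, (integrableOn_rpow_beta hb hη).mul_const M,
      {c | b.re + (c₀.re - b.re) / 2 < c.re},
      (isOpen_lt continuous_const Complex.continuous_re).mem_nhds
        (show b.re + (c₀.re - b.re) / 2 < c₀.re by linarith), ?_⟩
    filter_upwards [ae_restrict_mem measurableSet_Ioo] with t ht c hc
    rw [eulerIntegrand, norm_mul, norm_beta ht]
    refine mul_le_mul ?_ ((hM w (mem_of_mem_nhds hV)).2 t (Ioo_subset_Icc_self ht))
      (norm_nonneg _) (mul_nonneg (Real.rpow_nonneg ht.1.le _)
        (Real.rpow_nonneg (by linarith [ht.2]) _))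
    refine mul_le_mul_of_nonneg_left ?_ (Real.rpow_nonneg ht.1.le _)
    refine Real.rpow_le_rpow_of_exponent_ge (by linarith [ht.2]) (by linarith [ht.1]) ?_
    have : b.re + (c₀.re - b.re) / 2 < c.re := hc
    simp
    linarith

theorem integral_beta {b e : ℂ} (hb : 0 < b.re) (he : 0 < e.re) :
    ∫ t in Ioo (0 : ℝ) 1, (t : ℂ) ^ (b - 1) * (1 - (t : ℂ)) ^ (e - 1) =
      Complex.Gamma b * Complex.Gamma e / Complex.Gamma (b + e) := by
  rw [← Complex.betaIntegral_eq_Gamma_mul_div b e hb he, Complex.betaIntegral,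
    intervalIntegral.integral_of_le zero_le_one, integral_Ioc_eq_integral_Ioo]

theorem Gamma_add_nat_of_re_pos {s : ℂ} (hs : 0 < s.re) (n : ℕ) :
    Complex.Gamma (s + n) = (ascPochhammer ℂ n).eval s * Complex.Gamma s := by
  rw [← Complex.Gamma_add_nat_div_Gamma_eq s, div_mul_cancel₀ _ (Complex.Gamma_ne_zero_of_re_pos hs)]
  intro k hk
  rw [hk] at hs
  simp at hs
  linarith [(Nat.cast_nonneg k : (0 : ℝ) ≤ k)]

theorem norm_mul_mul_pow_le (α w : ℂ) {t : ℝ} (ht : t ∈ Ioo (0 : ℝ) 1) (n : ℕ) :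
    ‖α * (w * t) ^ n‖ ≤ ‖α‖ * ‖w‖ ^ n := by
  rw [norm_mul, norm_pow, norm_mul, mul_pow]
  have h1 : ‖(t : ℂ)‖ ^ n ≤ 1 := by
    rw [Complex.norm_of_nonneg ht.1.le]
    exact pow_le_one₀ ht.1.le ht.2.le
  gcongr
  exact mul_le_of_le_one_right (by positivity) h1

/-- Expand `(1 - wt)^(-a)` by the binomial series and integrate term by term; each term is a beta
integral, and `Γ(b+n)/Γ(c+n)` produces the Pochhammer symbols. -/
theorem eulerIntegral_eq_of_norm_lt_one (a : ℂ) {b c w : ℂ} (hb : 0 < b.re) (hc : b.re < c.re)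
    (hw : ‖w‖ < 1) :
    eulerIntegral a b c w = Complex.Gamma b * Complex.Gamma (c - b) / Complex.Gamma c *
      ordinaryHypergeometric a b c w := by
  have hcb : 0 < (c - b).re := by simpa using hc
  set β : ℝ → ℂ := fun t => (t : ℂ) ^ (b - 1) * (1 - (t : ℂ)) ^ (c - b - 1) with hβ
  set α : ℕ → ℂ := fun n => ordinaryHypergeometricCoefficient a 1 1 n with hα
  have hβi : IntegrableOn β (Ioo 0 1) := integrableOn_beta hb hcb
  have hint : ∀ n : ℕ, IntegrableOn (fun t => β t * (α n * (w * t) ^ n)) (Ioo 0 1) := by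
    intro n
    have hm : AEStronglyMeasurable (fun t : ℝ => β t * (α n * (w * t) ^ n))
        (volume.restrict (Ioo 0 1)) := by
      rw [hβ]; exact Measurable.aestronglyMeasurable (by fun_prop)
    refine (hβi.norm.mul_const (‖α n‖ * ‖w‖ ^ n)).mono' hm ?_
    filter_upwards [ae_restrict_mem measurableSet_Ioo] with t ht
    rw [norm_mul]
    exact mul_le_mul_of_nonneg_left (norm_mul_mul_pow_le _ _ ht n) (norm_nonneg _)
  have hval : ∀ n : ℕ, ∫ t in Ioo (0 : ℝ) 1, β t * (α n * (w * t) ^ n) =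
      Complex.Gamma b * Complex.Gamma (c - b) / Complex.Gamma c *
        (ordinaryHypergeometricCoefficient a b c n * w ^ n) := by
    intro n
    have h1 : ∫ t in Ioo (0 : ℝ) 1, β t * (α n * (w * t) ^ n) =
        α n * w ^ n * ∫ t in Ioo (0 : ℝ) 1,
          (t : ℂ) ^ (b + n - 1) * (1 - (t : ℂ)) ^ (c - b - 1) := by
      rw [← integral_const_mul]
      refine setIntegral_congr_fun measurableSet_Ioo fun t ht => ?_
      have : (t : ℂ) ≠ 0 := by exact_mod_cast ht.1.ne'
      simp only [hβ]
      rw [show b + n - 1 = (b - 1) + n by ring, Complex.cpow_add _ _ this, Complex.cpow_natCast]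
      ring
    rw [h1, integral_beta (by simp; positivity) hcb, show b + n + (c - b) = c + n by ring,
      Gamma_add_nat_of_re_pos hb, Gamma_add_nat_of_re_pos (hb.trans hc)]
    have h2 : (ascPochhammer ℂ n).eval c ≠ 0 := by
      intro h
      have := Gamma_add_nat_of_re_pos (hb.trans hc) n
      rw [h, zero_mul] at this
      refine Complex.Gamma_ne_zero_of_re_pos ?_ this
      have := hb.trans hc
      simp; positivity
    have h3 := Complex.Gamma_ne_zero_of_re_pos (hb.trans hc)
    have h4 : (ascPochhammer ℂ n).eval (1 : ℂ) ≠ 0 := by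
      rw [ascPochhammer_eval_one]; exact_mod_cast n.factorial_ne_zero
    simp only [hα, ordinaryHypergeometricCoefficient]
    field_simp
  have hsum : Summable fun n : ℕ => ∫ t in Ioo (0 : ℝ) 1, ‖β t * (α n * (w * t) ^ n)‖ := by
    refine Summable.of_nonneg_of_le (fun n => integral_nonneg fun t => norm_nonneg _) (fun n => ?_)
      ((hasSum_one_sub_cpow_neg a hw).summable.norm.mul_left (∫ t in Ioo (0 : ℝ) 1, ‖β t‖))
    rw [← integral_mul_const]
    refine setIntegral_mono_on (hint n).norm (hβi.norm.mul_const _) measurableSet_Ioo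
      fun t ht => ?_
    rw [norm_mul]
    refine mul_le_mul_of_nonneg_left ?_ (norm_nonneg _)
    rw [norm_mul _ (w ^ n), norm_pow]
    exact norm_mul_mul_pow_le _ _ ht n
  have h1 := hasSum_integral_of_summable_integral_norm hint hsum
  have h2 : ∫ t in Ioo (0 : ℝ) 1, ∑' n : ℕ, β t * (α n * (w * t) ^ n) =
      eulerIntegral a b c w := by
    refine setIntegral_congr_fun measurableSet_Ioo fun t ht => ?_
    rw [tsum_mul_left, (hasSum_one_sub_cpow_neg a (w := w * t) ?_).tsum_eq]
    · rfl
    · rw [norm_mul, Complex.norm_of_nonneg ht.1.le]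
      nlinarith [ht.1, ht.2, norm_nonneg w]
  rw [h2] at h1
  simp only [hval] at h1
  exact h1.unique ((hasSum_ordinaryHypergeometric a b c hw).mul_left _)

/-! ### Analytic continuation to the half-plane `re w < 1` -/

/-- The Gauss series continues analytically to the half-plane `re w < 1`, with `gaussF` as the
continuation. -/
def GaussRegular (a b c : ℂ) : Prop :=
  AnalyticOnNhd ℂ (gaussF a b c) {w | w.re < 1} ∧
    gaussF a b c =ᶠ[𝓝 0] ordinaryHypergeometric a b c

theorem isOpen_re_lt_one : IsOpen {w : ℂ | w.re < 1} :=
  isOpen_lt Complex.continuous_re continuous_const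

theorem convex_re_lt_one : Convex ℝ {w : ℂ | w.re < 1} :=
  convex_halfSpace_re_lt 1

/-- The half-plane is open and star-shaped about `0`, so any continuation to it witnesses
`IsGaussValue`. It contains the points `ξ/(ξ-1) < 0`, the only ones that matter. -/
theorem eqOn_gaussF {a b c : ℂ} {f : ℂ → ℂ} (hf : AnalyticOnNhd ℂ f {w | w.re < 1})
    (h0 : f =ᶠ[𝓝 0] ordinaryHypergeometric a b c) : EqOn (gaussF a b c) f {w | w.re < 1} :=
  fun _ hw => IsGaussValue.gaussF_eq ⟨_, f, isOpen_re_lt_one,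
    convex_re_lt_one.starConvex (by simp), hw, hf, h0, rfl⟩

theorem GaussRegular.of_continuation {a b c : ℂ} {f : ℂ → ℂ}
    (hf : AnalyticOnNhd ℂ f {w | w.re < 1}) (h0 : f =ᶠ[𝓝 0] ordinaryHypergeometric a b c) :
    GaussRegular a b c := by
  have h := eqOn_gaussF hf h0
  refine ⟨hf.congr isOpen_re_lt_one h.symm, EventuallyEq.trans ?_ h0⟩
  exact h.eventuallyEq_of_mem (isOpen_re_lt_one.mem_nhds (by simp))

theorem gaussF_eq_eulerIntegral (a : ℂ) {b c : ℂ} (hb : 0 < b.re) (hc : b.re < c.re) :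
    GaussRegular a b c ∧ ∀ w : ℂ, w.re < 1 → gaussF a b c w =
      Complex.Gamma c / (Complex.Gamma b * Complex.Gamma (c - b)) * eulerIntegral a b c w := by
  have hf : AnalyticOnNhd ℂ (fun w => Complex.Gamma c / (Complex.Gamma b * Complex.Gamma (c - b)) *
      eulerIntegral a b c w) {w | w.re < 1} :=
    ((differentiableOn_eulerIntegral a hb hc).const_mul _).analyticOnNhd isOpen_re_lt_one
  have h0 : (fun w => Complex.Gamma c / (Complex.Gamma b * Complex.Gamma (c - b)) *
      eulerIntegral a b c w) =ᶠ[𝓝 0] ordinaryHypergeometric a b c := by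
    filter_upwards [Metric.ball_mem_nhds (0 : ℂ) one_pos] with w hw
    rw [eulerIntegral_eq_of_norm_lt_one a hb hc (by simpa using hw)]
    have h1 := Complex.Gamma_ne_zero_of_re_pos hb
    have h2 := Complex.Gamma_ne_zero_of_re_pos (hb.trans hc)
    have h3 := Complex.Gamma_ne_zero_of_re_pos (s := c - b) (by simpa using hc)
    field_simp
  exact ⟨.of_continuation hf h0, fun w hw => eqOn_gaussF hf h0 hw⟩

/-! ### Contiguous relation in the second parameter -/

theorem mul_ascPochhammer_eval_add_one (x : ℂ) (n : ℕ) :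
    x * (ascPochhammer ℂ n).eval (x + 1) = (ascPochhammer ℂ n).eval x * (x + n) := by
  rw [← ascPochhammer_succ_eval, ascPochhammer_succ_left]
  simp

/-- Compare coefficients of `w^(n+1)`: the Pochhammer symbols of `b - 1`, `b`, `b + 1` share the
factor `(b)_n`. The constant terms cancel since `(c-b) + (2b-c) - b = 0`. -/
theorem ordinaryHypergeometric_contiguous (a b : ℂ) {c w : ℂ} (hc : 0 < c.re) (hw : ‖w‖ < 1) :
    (c - b) * ordinaryHypergeometric a (b - 1) c w +
      (2 * b - c + (a - b) * w) * ordinaryHypergeometric a b c w -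
      b * (1 - w) * ordinaryHypergeometric a (b + 1) c w = 0 := by
  set A := ordinaryHypergeometricCoefficient a (b - 1) c with hA
  set B := ordinaryHypergeometricCoefficient a b c with hB
  set C := ordinaryHypergeometricCoefficient a (b + 1) c with hC
  have sA := hasSum_ordinaryHypergeometric a (b - 1) c hw
  have sB := hasSum_ordinaryHypergeometric a b c hw
  have sC := hasSum_ordinaryHypergeometric a (b + 1) c hw
  have s1 := ((sA.mul_left (c - b)).add (sB.mul_left (2 * b - c))).sub (sC.mul_left b)
  have s2 := ((sB.mul_left (a - b)).add (sC.mul_left b)).mul_left w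
  have key : ∀ n, (c - b) * A (n + 1) + (2 * b - c) * B (n + 1) - b * C (n + 1) =
      -((a - b) * B n + b * C n) := by
    intro n
    have p1 : (ascPochhammer ℂ (n + 1)).eval (b - 1) = (b - 1) * (ascPochhammer ℂ n).eval b := by
      have := mul_ascPochhammer_eval_add_one (b - 1) n
      rw [sub_add_cancel] at this
      rw [this, ascPochhammer_succ_eval]
    have p2 := mul_ascPochhammer_eval_add_one b n
    have p3 := mul_ascPochhammer_eval_add_one b (n + 1)
    have hcn : (ascPochhammer ℂ n).eval c ≠ 0 ∧ c + n ≠ 0 := by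
      have h := Gamma_add_nat_of_re_pos hc (n + 1)
      rw [ascPochhammer_succ_eval] at h
      have h' : Complex.Gamma (c + (n + 1 : ℕ)) ≠ 0 :=
        Complex.Gamma_ne_zero_of_re_pos (by simp; positivity)
      rw [h] at h'
      exact ⟨left_ne_zero_of_mul (left_ne_zero_of_mul h'),
        right_ne_zero_of_mul (left_ne_zero_of_mul h')⟩
    obtain ⟨hc1, hc2⟩ := hcn
    have hn : ((n : ℂ) + 1) ≠ 0 := by exact_mod_cast n.succ_ne_zero
    have hf : (n.factorial : ℂ) ≠ 0 := by exact_mod_cast n.factorial_ne_zero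
    -- The factor `b` stays attached to `C`: `b (b+1)_n` reduces to `(b)_n (b+n)` even for `b = 0`,
    -- when division is impossible.
    have e1 : b * C (n + 1) = (((n + 1).factorial : ℂ)⁻¹) * (ascPochhammer ℂ (n + 1)).eval a *
        ((ascPochhammer ℂ n).eval b * (b + n) * (b + (n + 1))) *
        ((ascPochhammer ℂ (n + 1)).eval c)⁻¹ := by
      rw [← ascPochhammer_succ_eval, ← Nat.cast_add_one, ← p3, hC, ordinaryHypergeometricCoefficient]
      ring
    have e2 : b * C n = ((n.factorial : ℂ)⁻¹) * (ascPochhammer ℂ n).eval a *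
        ((ascPochhammer ℂ n).eval b * (b + n)) * ((ascPochhammer ℂ n).eval c)⁻¹ := by
      rw [← p2, hC, ordinaryHypergeometricCoefficient]
      ring
    rw [e1, e2, hA, hB]
    simp only [ordinaryHypergeometricCoefficient, p1, ascPochhammer_succ_eval, Nat.factorial_succ]
    push_cast
    field_simp
    ring
  have s3 := (hasSum_nat_add_iff' 1).2 s1
  have s4 := s2.neg
  have hfun : (fun n => (c - b) * (A (n + 1) * w ^ (n + 1)) +
      (2 * b - c) * (B (n + 1) * w ^ (n + 1)) - b * (C (n + 1) * w ^ (n + 1))) =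
      fun n => -(w * ((a - b) * (B n * w ^ n) + b * (C n * w ^ n))) := by
    funext n
    linear_combination w ^ (n + 1) * key n
  rw [hfun] at s3
  have := s3.unique s4
  simp only [Finset.range_one, Finset.sum_singleton] at this
  simp [ordinaryHypergeometricCoefficient] at this
  linear_combination this

theorem gaussF_contiguous {a b c w : ℂ} (hc : 0 < c.re) (h₁ : GaussRegular a (b - 1) c)
    (h₂ : GaussRegular a b c) (h₃ : GaussRegular a (b + 1) c) (hw : w.re < 1) :
    (c - b) * gaussF a (b - 1) c w + (2 * b - c + (a - b) * w) * gaussF a b c w -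
      b * (1 - w) * gaussF a (b + 1) c w = 0 := by
  have han : AnalyticOnNhd ℂ (fun w => (c - b) * gaussF a (b - 1) c w +
      (2 * b - c + (a - b) * w) * gaussF a b c w - b * (1 - w) * gaussF a (b + 1) c w)
      {w | w.re < 1} := by
    intro w hw
    have g₁ := h₁.1 w hw
    have g₂ := h₂.1 w hw
    have g₃ := h₃.1 w hw
    fun_prop
  refine han.eqOn_zero_of_preconnected_of_eventuallyEq_zero convex_re_lt_one.isPreconnected
    (z₀ := 0) (by simp) ?_ hw
  filter_upwards [h₁.2, h₂.2, h₃.2, Metric.ball_mem_nhds (0 : ℂ) one_pos] with w e₁ e₂ e₃ hw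
  rw [e₁, e₂, e₃]
  exact ordinaryHypergeometric_contiguous a b hc (by simpa using hw)

theorem GaussRegular.sub_one {a b c : ℂ} (hc : 0 < c.re) (hbc : c ≠ b)
    (h₂ : GaussRegular a b c) (h₃ : GaussRegular a (b + 1) c) : GaussRegular a (b - 1) c := by
  have hcb : c - b ≠ 0 := sub_ne_zero.2 hbc
  refine .of_continuation (f := fun w => (b * (1 - w) * gaussF a (b + 1) c w -
    (2 * b - c + (a - b) * w) * gaussF a b c w) / (c - b)) ?_ ?_
  · intro w hw
    have g₂ := h₂.1 w hw
    have g₃ := h₃.1 w hw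
    fun_prop
  · filter_upwards [h₂.2, h₃.2, Metric.ball_mem_nhds (0 : ℂ) one_pos] with w e₂ e₃ hw
    rw [e₂, e₃, div_eq_iff hcb]
    linear_combination -ordinaryHypergeometric_contiguous a b hc (w := w) (by simpa using hw)

/-- Descent from the range of Euler's integral through the contiguous relation. Each step down calls
on `b + 1` and `b + 2`, so `re c` must exceed `re b` by `2n`. -/
theorem gaussRegular_of_re (a : ℂ) (n : ℕ) {b c : ℂ} (hb : -(n : ℝ) < b.re) (hc : 0 < c.re)
    (hbc : b.re + 2 * n < c.re) : GaussRegular a b c := by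
  induction n generalizing b with
  | zero => exact (gaussF_eq_eulerIntegral a (by simpa using hb) (by simpa using hbc)).1
  | succ n ih =>
    push_cast at hb hbc
    rw [show b = b + 1 - 1 by ring]
    refine GaussRegular.sub_one hc ?_ (ih ?_ ?_) (ih ?_ ?_)
    · intro h
      rw [h] at hbc
      have : (0 : ℝ) ≤ n := Nat.cast_nonneg n
      simp at hbc
      linarith
    all_goals simp; linarith

/-! ### The Laplace integral -/

/-- The integrand of the Laplace integral for the confluent hypergeometric function. -/
def laplaceIntegrand (a b x : ℂ) (s : ℝ) : ℂ :=
  (s : ℂ) ^ (b - 1) * Complex.exp (-(x * s)) * (1 + (s : ℂ)) ^ (-a)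

/-- The Laplace integral for the confluent hypergeometric function, without the Gamma factor. -/
def laplaceIntegral (a b x : ℂ) : ℂ := ∫ s in Ioi (0 : ℝ), laplaceIntegrand a b x s

/-- A common bound for the Laplace integrands and their approximations. -/
def laplaceBound (p A δ s : ℝ) : ℝ := s ^ (p - 1) * Real.exp (-δ * s) * (1 + s) ^ A

/-- The inequality `(1+s)^A ≤ 2^A (1 + s^A)` reduces the claim to two Gamma integrals. -/
theorem integrableOn_laplaceBound {p A δ : ℝ} (hp : 0 < p) (hA : 0 ≤ A) (hδ : 0 < δ) :
    IntegrableOn (laplaceBound p A δ) (Ioi 0) := by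
  have h : ∀ q : ℝ, 0 < q → IntegrableOn (fun s : ℝ => s ^ (q - 1) * Real.exp (-δ * s)) (Ioi 0) := by
    intro q hq
    have := integrableOn_rpow_mul_exp_neg_mul_rpow (p := 1) (s := q - 1) (b := δ) (by linarith)
      one_pos hδ
    simpa using this
  refine Integrable.mono' (((h p hp).add (h (p + A) (by positivity))).const_mul (2 ^ A)) ?_ ?_
  · unfold laplaceBound
    exact Measurable.aestronglyMeasurable (by fun_prop)
  · filter_upwards [ae_restrict_mem measurableSet_Ioi] with s hs
    have hs : 0 < s := hs
    rw [laplaceBound, Real.norm_of_nonneg (by positivity)]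
    have h1 : (1 + s) ^ A ≤ 2 ^ A * (1 + s ^ A) := by
      rcases le_total s 1 with h | h
      · calc (1 + s) ^ A ≤ 2 ^ A := Real.rpow_le_rpow (by positivity) (by linarith) hA
          _ ≤ 2 ^ A * (1 + s ^ A) := le_mul_of_one_le_right (by positivity)
              (by linarith [Real.rpow_nonneg hs.le A])
      · calc (1 + s) ^ A ≤ (2 * s) ^ A := Real.rpow_le_rpow (by positivity) (by linarith) hA
          _ = 2 ^ A * s ^ A := Real.mul_rpow (by positivity) hs.le
          _ ≤ 2 ^ A * (1 + s ^ A) := by gcongr; linarith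
    calc s ^ (p - 1) * Real.exp (-δ * s) * (1 + s) ^ A
        ≤ s ^ (p - 1) * Real.exp (-δ * s) * (2 ^ A * (1 + s ^ A)) := by gcongr
      _ = _ := by
        simp only [Pi.add_apply]
        rw [show p + A - 1 = (p - 1) + A by ring, Real.rpow_add hs]
        ring

theorem measurable_laplaceIntegrand (a b x : ℂ) : Measurable (laplaceIntegrand a b x) := by
  unfold laplaceIntegrand
  fun_prop

theorem norm_one_add_cpow_le (a : ℂ) {r s : ℝ} (hr : 0 ≤ r) (hrs : r ≤ s) :
    ‖(1 + (r : ℂ)) ^ (-a)‖ ≤ (1 + s) ^ |a.re| := by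
  rw [← Complex.ofReal_one, ← Complex.ofReal_add,
    Complex.norm_cpow_eq_rpow_re_of_pos (by positivity)]
  calc (1 + r) ^ (-a).re ≤ (1 + r) ^ |a.re| :=
        Real.rpow_le_rpow_of_exponent_le (by linarith) (by simpa using neg_le_abs a.re)
    _ ≤ _ := Real.rpow_le_rpow (by positivity) (by linarith) (abs_nonneg _)

theorem norm_laplaceIntegrand_le (a b : ℂ) {x : ℂ} {δ s : ℝ} (hx : δ ≤ x.re) (hs : 0 < s) :
    ‖laplaceIntegrand a b x s‖ ≤ laplaceBound b.re |a.re| δ s := by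
  rw [laplaceIntegrand, laplaceBound, norm_mul, norm_mul, Complex.norm_cpow_eq_rpow_re_of_pos hs,
    Complex.norm_exp, Complex.sub_re, Complex.one_re]
  have : Real.exp (-(x * s)).re ≤ Real.exp (-δ * s) := by
    apply Real.exp_le_exp.2
    simp
    gcongr
  gcongr
  exact norm_one_add_cpow_le a hs.le le_rfl

theorem integrableOn_laplaceIntegrand (a : ℂ) {b x : ℂ} (hb : 0 < b.re) (hx : 0 < x.re) :
    IntegrableOn (laplaceIntegrand a b x) (Ioi 0) := by
  refine (integrableOn_laplaceBound hb (abs_nonneg a.re) hx).mono'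
    (measurable_laplaceIntegrand a b x).aestronglyMeasurable ?_
  filter_upwards [ae_restrict_mem measurableSet_Ioi] with s hs
  exact norm_laplaceIntegrand_le a b le_rfl hs

theorem hasDerivAt_laplaceIntegral (a : ℂ) {b x : ℂ} (hb : 0 < b.re) (hx : 0 < x.re) :
    HasDerivAt (laplaceIntegral a b) (-laplaceIntegral a (b + 1) x) x := by
  have hV : {y : ℂ | x.re / 2 < y.re} ∈ 𝓝 x :=
    (isOpen_lt continuous_const Complex.continuous_re).mem_nhds
      (show x.re / 2 < x.re by linarith)
  have h := hasDerivAt_integral_of_dominated_loc_of_deriv_le (μ := volume.restrict (Ioi (0 : ℝ)))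
    (F := laplaceIntegrand a b) (F' := fun y s => -laplaceIntegrand a (b + 1) y s)
    (bound := laplaceBound (b + 1).re |a.re| (x.re / 2)) hV
    (.of_forall fun y => (measurable_laplaceIntegrand a b y).aestronglyMeasurable)
    (integrableOn_laplaceIntegrand a hb hx)
    (measurable_laplaceIntegrand a (b + 1) x).neg.aestronglyMeasurable ?_
    (integrableOn_laplaceBound (by simp; positivity) (abs_nonneg _) (by positivity)) ?_
  · have := h.2
    rw [integral_neg] at this
    exact this
  · filter_upwards [ae_restrict_mem measurableSet_Ioi] with s hs y hy
    rw [norm_neg]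
    exact norm_laplaceIntegrand_le a _ (le_of_lt hy) hs
  · filter_upwards [ae_restrict_mem measurableSet_Ioi] with s hs y hy
    have hs0 : (s : ℂ) ≠ 0 := by
      have : (0 : ℝ) < s := hs
      exact_mod_cast this.ne'
    have h1 : HasDerivAt (fun y : ℂ => -(y * s)) (-(1 * (s : ℂ))) y :=
      ((hasDerivAt_id y).mul_const (s : ℂ)).neg
    have h2 := ((h1.cexp.const_mul ((s : ℂ) ^ (b - 1))).mul_const ((1 + (s : ℂ)) ^ (-a)))
    refine h2.congr_deriv ?_
    rw [laplaceIntegrand, show b + 1 - 1 = (b - 1) + 1 by ring, Complex.cpow_add _ _ hs0,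
      Complex.cpow_one]
    ring

/-- For real `x` this is the Gamma integral; the points `1 + 1/(n+1)` accumulate at `1`, so the
identity theorem gives it on the half-plane. -/
theorem laplaceIntegral_zero {b x : ℂ} (hb : 0 < b.re) (hx : 0 < x.re) :
    laplaceIntegral 0 b x = Complex.Gamma b * x ^ (-b) := by
  have hopen : IsOpen {x : ℂ | 0 < x.re} := isOpen_lt continuous_const Complex.continuous_re
  have h1 : AnalyticOnNhd ℂ (laplaceIntegral 0 b) {x | 0 < x.re} :=
    DifferentiableOn.analyticOnNhd (fun y hy =>
      (hasDerivAt_laplaceIntegral 0 hb hy).differentiableAt.differentiableWithinAt) hopen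
  have h2 : AnalyticOnNhd ℂ (fun x : ℂ => Complex.Gamma b * x ^ (-b)) {x | 0 < x.re} :=
    DifferentiableOn.analyticOnNhd (fun y hy =>
      ((differentiableAt_id.cpow_const (Or.inl hy)).const_mul _).differentiableWithinAt) hopen
  have hreal : ∀ r : ℝ, 0 < r → laplaceIntegral 0 b r = Complex.Gamma b * (r : ℂ) ^ (-b) := by
    intro r hr
    have h := Complex.integral_cpow_mul_exp_neg_mul_Ioi hb hr
    rw [laplaceIntegral]
    simp only [laplaceIntegrand, neg_zero, Complex.cpow_zero, mul_one]
    rw [h, mul_comm, one_div, Complex.inv_cpow _ _ (by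
      rw [Complex.arg_ofReal_of_nonneg hr.le]; exact Real.pi_pos.ne), Complex.cpow_neg]
  refine h1.eqOn_of_preconnected_of_frequently_eq h2
    (convex_halfSpace_re_gt 0).isPreconnected (z₀ := 1) (by simp) ?_ hx
  have hu : Tendsto (fun n : ℕ => (1 : ℂ) + ((n : ℂ) + 1)⁻¹) atTop (𝓝[≠] 1) := by
    refine tendsto_nhdsWithin_iff.2 ⟨?_, .of_forall fun n => ?_⟩
    · have := (tendsto_one_div_add_atTop_nhds_zero_nat (𝕜 := ℂ)).const_add 1
      simpa using this
    · have : (n : ℂ) + 1 ≠ 0 := by exact_mod_cast n.succ_ne_zero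
      simpa using this
  refine hu.frequently (Frequently.of_forall fun n => ?_)
  have := hreal (1 + ((n : ℝ) + 1)⁻¹) (by positivity)
  push_cast at this
  exact this

/-- Replacing `s` by `s / x` turns `(1+s)^(-a)` into `(1+s/x)^(-a)`, which tends to `1` and is
dominated uniformly for `x ≥ 1`; what remains is the Gamma integral. -/
theorem tendsto_laplaceIntegral_atTop (a : ℂ) {b : ℂ} (hb : 0 < b.re) :
    Tendsto (fun x : ℝ => (x : ℂ) ^ b * laplaceIntegral a b x) atTop (𝓝 (Complex.Gamma b)) := by
  have h0 : ∀ᶠ x : ℝ in atTop, (x : ℂ) ^ b * laplaceIntegral a b x =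
      ∫ s in Ioi (0 : ℝ), (s : ℂ) ^ (b - 1) * Complex.exp (-s) * (1 + ((s / x : ℝ) : ℂ)) ^ (-a) := by
    filter_upwards [eventually_gt_atTop 0] with x hx
    have h := integral_comp_mul_left_Ioi (fun s : ℝ => (s : ℂ) ^ (b - 1) * Complex.exp (-s) *
      (1 + ((s / x : ℝ) : ℂ)) ^ (-a)) 0 hx
    rw [mul_zero] at h
    have hx0 : (x : ℂ) ≠ 0 := by exact_mod_cast hx.ne'
    have h2 : ∀ I : ℂ, x⁻¹ • I = (x : ℂ)⁻¹ * I := fun I => by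
      rw [Complex.real_smul, Complex.ofReal_inv]
    rw [h2] at h
    rw [← mul_right_inj' (inv_ne_zero hx0), ← h, laplaceIntegral, ← mul_assoc,
      ← integral_const_mul]
    refine setIntegral_congr_fun measurableSet_Ioi fun s hs => ?_
    have hs : 0 < s := hs
    simp only [laplaceIntegrand]
    rw [mul_div_cancel_left₀ _ hx.ne']
    push_cast
    rw [Complex.mul_cpow_ofReal_nonneg hx.le hs.le, Complex.cpow_sub _ _ hx0, Complex.cpow_one]
    field_simp
  refine Tendsto.congr' (EventuallyEq.symm h0) ?_
  have h1 : Complex.Gamma b = ∫ s in Ioi (0 : ℝ), (s : ℂ) ^ (b - 1) * Complex.exp (-s) := by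
    rw [Complex.Gamma_eq_integral hb, Complex.GammaIntegral]
    refine setIntegral_congr_fun measurableSet_Ioi fun s hs => ?_
    push_cast
    ring
  rw [h1]
  refine tendsto_integral_filter_of_dominated_convergence (laplaceBound b.re |a.re| 1)
    (.of_forall fun x => Measurable.aestronglyMeasurable (by fun_prop)) ?_
    (integrableOn_laplaceBound hb (abs_nonneg _) one_pos) ?_
  · filter_upwards [eventually_ge_atTop 1] with x hx
    filter_upwards [ae_restrict_mem measurableSet_Ioi] with s hs
    have hs : 0 < s := hs
    rw [laplaceBound, norm_mul, norm_mul, Complex.norm_cpow_eq_rpow_re_of_pos hs, Complex.norm_exp,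
      Complex.sub_re, Complex.one_re, Complex.neg_re, Complex.ofReal_re, neg_one_mul]
    gcongr
    exact norm_one_add_cpow_le a (by positivity) (div_le_self hs.le hx)
  · filter_upwards [ae_restrict_mem measurableSet_Ioi] with s hs
    have h2 : Tendsto (fun x : ℝ => 1 + ((s / x : ℝ) : ℂ)) atTop (𝓝 1) := by
      have := (Complex.continuous_ofReal.tendsto _).comp (tendsto_const_nhds (x := s).div_atTop
        (tendsto_id (x := atTop)))
      simpa using this.const_add 1
    have h3 := (Tendsto.comp (continuousAt_cpow_const (b := -a) (by simp)).tendsto h2).const_mul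
      ((s : ℂ) ^ (b - 1) * Complex.exp (-s))
    simpa [Function.comp_def] using h3

/-! ### Scaling limit of Euler's integral -/

/-- The rescaled integrand of Euler's integral. -/
def scaledIntegrand (a b d : ℂ) (ξ : ℝ) (x : ℂ) (s : ℝ) : ℂ :=
  if (1 - ξ) * s < 1 then (s : ℂ) ^ (b - 1) *
    (1 - (((1 - ξ) * s : ℝ) : ℂ)) ^ (x / (1 - ξ) + d - b - 1) * (1 + ((ξ * s : ℝ) : ℂ)) ^ (-a)
  else 0

theorem measurable_scaledIntegrand (a b d : ℂ) (ξ : ℝ) (x : ℂ) :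
    Measurable (scaledIntegrand a b d ξ x) := by
  unfold scaledIntegrand
  exact Measurable.ite (measurableSet_lt (by fun_prop) (by fun_prop)) (by fun_prop) (by fun_prop)

/-- Substitute `t = (1-ξ)s`; for `w = ξ/(ξ-1)` the factor `1 - wt` becomes `1 + ξs`, and `t < 1`
becomes the cutoff of the integrand. -/
theorem integral_scaledIntegrand (a b d : ℂ) {ξ : ℝ} (hξ : ξ < 1) (x : ℂ) :
    (1 - (ξ : ℂ)) ^ (-b) * eulerIntegral a b (x / (1 - ξ) + d) (ξ / (ξ - 1)) =
      ∫ s in Ioi (0 : ℝ), scaledIntegrand a b d ξ x s := by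
  have hε : 0 < 1 - ξ := by linarith
  have hε0 : (1 - (ξ : ℂ)) ≠ 0 := by exact_mod_cast hε.ne'
  set f := eulerIntegrand a b (x / (1 - ξ) + d) (ξ / (ξ - 1)) with hf
  have h1 : eulerIntegral a b (x / (1 - ξ) + d) (ξ / (ξ - 1)) =
      ∫ t in Ioi (0 : ℝ), (Iio (1 : ℝ)).indicator f t := by
    rw [setIntegral_indicator measurableSet_Iio, Ioi_inter_Iio]
    rfl
  have h2 := integral_comp_mul_left_Ioi ((Iio (1 : ℝ)).indicator f) 0 hε
  rw [mul_zero, ← h1, Complex.real_smul] at h2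
  have h3 : eulerIntegral a b (x / (1 - ξ) + d) (ξ / (ξ - 1)) =
      (1 - (ξ : ℂ)) * ∫ s in Ioi (0 : ℝ), (Iio (1 : ℝ)).indicator f ((1 - ξ) * s) := by
    rw [h2]
    push_cast
    field_simp
  rw [h3, ← mul_assoc, ← integral_const_mul]
  refine setIntegral_congr_fun measurableSet_Ioi fun s hs => ?_
  have hs : 0 < s := hs
  simp only [scaledIntegrand, indicator, mem_Iio]
  split_ifs with h
  · rw [hf, eulerIntegrand]
    have e1 : (1 : ℂ) - ξ / (ξ - 1) * (((1 - ξ) * s : ℝ) : ℂ) = 1 + ((ξ * s : ℝ) : ℂ) := by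
      have : (ξ : ℂ) - 1 ≠ 0 := by rw [← neg_sub]; exact neg_ne_zero.2 hε0
      push_cast
      field_simp
      ring
    have e2 : (1 - (ξ : ℂ)) ^ (-b) * (1 - ξ) * (((1 - ξ) * s : ℝ) : ℂ) ^ (b - 1) =
        (s : ℂ) ^ (b - 1) := by
      rw [Complex.ofReal_mul, Complex.mul_cpow_ofReal_nonneg hε.le hs.le]
      push_cast
      have h5 : (1 - (ξ : ℂ)) ^ b ≠ 0 := by
        rw [Ne, Complex.cpow_eq_zero_iff]; tauto
      rw [Complex.cpow_neg, Complex.cpow_sub _ _ hε0, Complex.cpow_one]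
      field_simp
    rw [e1, ← e2]
    ring
  · rw [mul_zero]

/-- The quotient `log(1 - (1-ξ)s) / (1-ξ)` is minus a difference quotient at `ξ = 1` and tends to
`-s`; the shift `d` multiplies a logarithm tending to `0`. -/
theorem tendsto_one_sub_cpow (d x₀ : ℂ) (s : ℝ) :
    Tendsto (fun p : ℝ × ℂ => (1 - (((1 - p.1) * s : ℝ) : ℂ)) ^ (p.2 / (1 - p.1) + d))
      (𝓝[<] (1 : ℝ) ×ˢ 𝓝 x₀) (𝓝 (Complex.exp (-(x₀ * s)))) := by
  have hξ : Tendsto (fun p : ℝ × ℂ => p.1) (𝓝[<] (1 : ℝ) ×ˢ 𝓝 x₀) (𝓝[<] 1) := tendsto_fst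
  have hx : Tendsto (fun p : ℝ × ℂ => p.2) (𝓝[<] (1 : ℝ) ×ˢ 𝓝 x₀) (𝓝 x₀) := tendsto_snd
  have hlog : Tendsto (fun ξ : ℝ => Real.log (1 - (1 - ξ) * s) / (1 - ξ)) (𝓝[<] 1) (𝓝 (-s)) := by
    have h1 : HasDerivAt (fun ξ : ℝ => Real.log (1 - (1 - ξ) * s)) s 1 := by
      have h2 : HasDerivAt (fun ξ : ℝ => 1 - (1 - ξ) * s) s 1 := by
        have := ((((hasDerivAt_id (1 : ℝ)).const_sub 1).mul_const s).const_sub 1)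
        simpa using this
      have := h2.log (by simp)
      simpa using this
    have h3 := ((hasDerivAt_iff_tendsto_slope.1 h1).mono_left
      (nhdsWithin_mono _ fun y (hy : y < 1) => hy.ne)).neg
    refine h3.congr' ?_
    filter_upwards [self_mem_nhdsWithin] with ξ (hξ : ξ < 1)
    have : ξ - 1 ≠ 0 := by linarith
    have h' : 1 - ξ ≠ 0 := by linarith
    rw [slope_def_field]
    simp
    field_simp
    ring
  have hlog0 : Tendsto (fun ξ : ℝ => Real.log (1 - (1 - ξ) * s)) (𝓝[<] 1) (𝓝 0) := by
    have h1 : ContinuousAt (fun ξ : ℝ => Real.log (1 - (1 - ξ) * s)) 1 :=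
      ContinuousAt.log (by fun_prop) (by simp)
    have := h1.tendsto.mono_left (nhdsWithin_le_nhds (s := Iio (1 : ℝ)))
    simpa using this
  have hl := ((Complex.continuous_ofReal.tendsto _).comp (hlog.comp hξ)).mul hx
  have hl0 := ((Complex.continuous_ofReal.tendsto _).comp (hlog0.comp hξ)).mul
    (tendsto_const_nhds (x := d))
  have hsum := (hl.add hl0).cexp
  have hval : ((-s : ℝ) : ℂ) * x₀ + ((0 : ℝ) : ℂ) * d = -(x₀ * s) := by push_cast; ring
  rw [hval] at hsum
  refine hsum.congr' ?_
  have hev : ∀ᶠ ξ : ℝ in 𝓝[<] 1, 0 < 1 - (1 - ξ) * s := by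
    have h1 : ContinuousAt (fun ξ : ℝ => 1 - (1 - ξ) * s) 1 := by fun_prop
    have := h1.tendsto.mono_left (nhdsWithin_le_nhds (s := Iio (1 : ℝ)))
    exact this.eventually (lt_mem_nhds (by simp))
  filter_upwards [hξ.eventually hev] with p hp
  have hne : (1 - (((1 - p.1) * s : ℝ) : ℂ)) ≠ 0 := by
    rw [← Complex.ofReal_one, ← Complex.ofReal_sub]
    exact_mod_cast hp.ne'
  rw [Complex.cpow_def_of_ne_zero hne]
  congr 1
  rw [← Complex.ofReal_one, ← Complex.ofReal_sub, ← Complex.ofReal_log hp.le]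
  simp only [Function.comp]
  push_cast
  ring

/-- Near the point `1` from the left, the points `x / (1 - ξ) + d` have large real part. -/
theorem eventually_lt_re (d : ℂ) {x₀ : ℂ} (hx₀ : 0 < x₀.re) (M : ℝ) :
    ∀ᶠ p : ℝ × ℂ in 𝓝[<] (1 : ℝ) ×ˢ 𝓝 x₀,
      M + x₀.re / 4 / (1 - p.1) < (p.2 / (1 - p.1) + d).re := by
  -- Of `re x₀`, one half is given up to let `x` vary and a quarter to absorb `M` and `d`; the last
  -- quarter, still divided by `1 - ξ`, is the decay rate in the domination below.
  have h1 : ∀ᶠ x in 𝓝 x₀, x₀.re / 2 < x.re :=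
    (isOpen_lt continuous_const Complex.continuous_re).mem_nhds
      (show x₀.re / 2 < x₀.re by linarith)
  have h2 : ∀ᶠ ξ : ℝ in 𝓝[<] 1, (M - d.re) * (1 - ξ) < x₀.re / 4 := by
    have h1 : ContinuousAt (fun ξ : ℝ => (M - d.re) * (1 - ξ)) 1 := by fun_prop
    have := h1.tendsto.mono_left (nhdsWithin_le_nhds (s := Iio (1 : ℝ)))
    exact this.eventually (gt_mem_nhds (by simpa using hx₀))
  filter_upwards [(h2.and self_mem_nhdsWithin).prod_mk h1] with p hp
  obtain ⟨⟨hp1, hp2⟩, hp3⟩ := hp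
  have hε : 0 < 1 - p.1 := by have : p.1 < 1 := hp2; linarith
  have e : (p.2 / (1 - p.1) + d).re = p.2.re / (1 - p.1) + d.re := by
    rw [← Complex.ofReal_one, ← Complex.ofReal_sub, Complex.add_re, Complex.div_ofReal_re]
  rw [e, ← sub_pos]
  have : p.2.re / (1 - p.1) + d.re - (M + x₀.re / 4 / (1 - p.1)) =
      (p.2.re - x₀.re / 4 - (M - d.re) * (1 - p.1)) / (1 - p.1) := by
    field_simp
    ring
  rw [this]
  apply div_pos _ hε
  linarith

theorem eventually_mem_Ioo : ∀ᶠ ξ : ℝ in 𝓝[<] 1, ξ ∈ Ioo (0 : ℝ) 1 :=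
  Ioo_mem_nhdsLT one_pos

theorem re_div_sub_one_lt {ξ : ℝ} (hξ : ξ ∈ Ioo (0 : ℝ) 1) : ((ξ : ℂ) / (ξ - 1)).re < 1 := by
  rw [← Complex.ofReal_one, ← Complex.ofReal_sub, ← Complex.ofReal_div, Complex.ofReal_re]
  have : ξ / (ξ - 1) < 0 := div_neg_of_pos_of_neg hξ.1 (by linarith [hξ.2])
  linarith

theorem tendsto_scaledIntegral (a d : ℂ) {b x₀ : ℂ} (hb : 0 < b.re) (hx₀ : 0 < x₀.re) :
    Tendsto (fun p : ℝ × ℂ => ∫ s in Ioi (0 : ℝ), scaledIntegrand a b d p.1 p.2 s)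
      (𝓝[<] (1 : ℝ) ×ˢ 𝓝 x₀) (𝓝 (laplaceIntegral a b x₀)) := by
  have hfst : Tendsto (fun p : ℝ × ℂ => p.1) (𝓝[<] (1 : ℝ) ×ˢ 𝓝 x₀) (𝓝[<] 1) := tendsto_fst
  refine tendsto_integral_filter_of_dominated_convergence (laplaceBound b.re |a.re| (x₀.re / 4))
    (.of_forall fun p => (measurable_scaledIntegrand a b d p.1 p.2).aestronglyMeasurable) ?_
    (integrableOn_laplaceBound hb (abs_nonneg _) (by positivity)) ?_
  · filter_upwards [hfst.eventually eventually_mem_Ioo, eventually_lt_re (d - b - 1) hx₀ 0]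
      with p hp1 hp2
    have hε : 0 < 1 - p.1 := by linarith [hp1.2]
    filter_upwards [ae_restrict_mem measurableSet_Ioi] with s hs
    have hs : 0 < s := hs
    rw [scaledIntegrand]
    split_ifs with h
    · rw [laplaceBound, norm_mul, norm_mul, Complex.norm_cpow_eq_rpow_re_of_pos hs,
        Complex.sub_re, Complex.one_re]
      -- Here `1 - y ≤ e^(-y)` with `y = (1-ξ)s`: raised to the power `re x₀ / (4(1-ξ))` it gives a
      -- bound free of `ξ`.
      have h1 : ‖(1 - (((1 - p.1) * s : ℝ) : ℂ)) ^ (p.2 / (1 - p.1) + d - b - 1)‖ ≤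
          Real.exp (-(x₀.re / 4) * s) := by
        have hpos : 0 < 1 - (1 - p.1) * s := by linarith
        have hle : 1 - (1 - p.1) * s ≤ 1 := by nlinarith
        rw [← Complex.ofReal_one, ← Complex.ofReal_sub, Complex.norm_cpow_eq_rpow_re_of_pos hpos]
        rw [zero_add, ← add_sub_assoc, ← add_sub_assoc] at hp2
        rw [Complex.ofReal_one]
        calc _ ≤ (1 - (1 - p.1) * s) ^ (x₀.re / 4 / (1 - p.1)) :=
              Real.rpow_le_rpow_of_exponent_ge hpos hle hp2.le
          _ ≤ (Real.exp (-((1 - p.1) * s))) ^ (x₀.re / 4 / (1 - p.1)) := by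
              apply Real.rpow_le_rpow hpos.le _ (by positivity)
              linarith [Real.add_one_le_exp (-((1 - p.1) * s))]
          _ = _ := by
              rw [← Real.exp_mul]
              congr 1
              field_simp
      have h2 := norm_one_add_cpow_le a (r := p.1 * s) (s := s) (mul_nonneg hp1.1.le hs.le)
        (by nlinarith [hp1.2])
      gcongr
    · rw [norm_zero, laplaceBound]
      positivity
  · filter_upwards [ae_restrict_mem measurableSet_Ioi] with s hs
    have hs : 0 < s := hs
    have h1 := tendsto_one_sub_cpow (d - b - 1) x₀ s
    have h2 : Tendsto (fun p : ℝ × ℂ => (1 + ((p.1 * s : ℝ) : ℂ)) ^ (-a))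
        (𝓝[<] (1 : ℝ) ×ˢ 𝓝 x₀) (𝓝 ((1 + (s : ℂ)) ^ (-a))) := by
      have hc : ContinuousAt (fun ξ : ℝ => (1 + ((ξ * s : ℝ) : ℂ)) ^ (-a)) 1 := by
        refine ContinuousAt.cpow (by fun_prop) (by fun_prop) (Or.inl ?_)
        simp
        positivity
      have := (hc.tendsto.mono_left (nhdsWithin_le_nhds (s := Iio (1 : ℝ)))).comp hfst
      simpa [Function.comp_def] using this
    have h3 := (h1.const_mul ((s : ℂ) ^ (b - 1))).mul h2
    refine h3.congr' ?_
    have hev : ∀ᶠ ξ : ℝ in 𝓝[<] 1, (1 - ξ) * s < 1 := by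
      have h1 : ContinuousAt (fun ξ : ℝ => (1 - ξ) * s) 1 := by fun_prop
      have := h1.tendsto.mono_left (nhdsWithin_le_nhds (s := Iio (1 : ℝ)))
      exact this.eventually (gt_mem_nhds (by simp))
    filter_upwards [hfst.eventually hev] with p hp
    rw [scaledIntegrand, if_pos hp, add_sub_assoc, add_sub_assoc]

theorem eventually_re_pos {x₀ : ℂ} (hx₀ : 0 < x₀.re) : ∀ᶠ x in 𝓝 x₀, 0 < x.re :=
  (isOpen_lt continuous_const Complex.continuous_re).mem_nhds hx₀

theorem holLim_eulerIntegral (a d : ℂ) {b x₀ : ℂ} (hb : 0 < b.re) (hx₀ : 0 < x₀.re) :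
    HolLim (𝓝[<] (1 : ℝ)) (fun ξ x => (1 - (ξ : ℂ)) ^ (-b) *
      eulerIntegral a b (x / (1 - ξ) + d) (ξ / (ξ - 1))) (laplaceIntegral a b) x₀ := by
  refine ⟨?_, ?_⟩
  · have hfst : Tendsto (fun p : ℝ × ℂ => p.1) (𝓝[<] (1 : ℝ) ×ˢ 𝓝 x₀) (𝓝[<] 1) := tendsto_fst
    filter_upwards [hfst.eventually eventually_mem_Ioo, eventually_lt_re d hx₀ b.re] with p h1 h2
    have hopen : IsOpen {c : ℂ | b.re < c.re} := isOpen_lt continuous_const Complex.continuous_re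
    have hε : 0 < 1 - p.1 := by linarith [h1.2]
    have h3 : b.re < (p.2 / (1 - p.1) + d).re := by
      have : 0 ≤ x₀.re / 4 / (1 - p.1) := by positivity
      linarith
    have h4 := (differentiableOn_eulerIntegral_param a hb (re_div_sub_one_lt h1)).differentiableAt
      (hopen.mem_nhds h3)
    refine DifferentiableAt.const_mul ?_ _
    exact DifferentiableAt.comp p.2 h4 (f := fun x : ℂ => x / (1 - p.1) + d) (by fun_prop)
  · filter_upwards [eventually_re_pos hx₀] with x hx
    refine (tendsto_scaledIntegral a d hb hx).congr' ?_
    have hfst : Tendsto (fun p : ℝ × ℂ => p.1) (𝓝[<] (1 : ℝ) ×ˢ 𝓝 x) (𝓝[<] 1) := tendsto_fst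
    filter_upwards [hfst.eventually self_mem_nhdsWithin] with p hp
    exact (integral_scaledIntegrand a b d hp p.2).symm

/-! ### Asymptotics of Gamma quotients -/

theorem one_sub_ne_zero_of_lt {ξ : ℝ} (hξ : ξ < 1) : (1 - (ξ : ℂ)) ≠ 0 := by
  have : (1 - ξ) ≠ 0 := by linarith
  exact_mod_cast this

theorem ne_zero_of_re_pos {x : ℂ} (hx : 0 < x.re) : x ≠ 0 := by
  rintro rfl
  simp at hx

theorem cpow_ne_zero_of_ne_zero {x : ℂ} (hx : x ≠ 0) (y : ℂ) : x ^ y ≠ 0 := by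
  rw [Ne, Complex.cpow_eq_zero_iff]
  tauto

theorem eulerIntegral_zero {b c : ℂ} (w : ℂ) (hb : 0 < b.re) (hc : b.re < c.re) :
    eulerIntegral 0 b c w = Complex.Gamma b * Complex.Gamma (c - b) / Complex.Gamma c := by
  have h := integral_beta hb (e := c - b) (by simpa using hc)
  rw [add_sub_cancel] at h
  rw [← h, eulerIntegral]
  simp only [eulerIntegrand, neg_zero, Complex.cpow_zero, mul_one]

theorem eventually_fst_lt_one {x₀ : ℂ} : ∀ᶠ p : ℝ × ℂ in 𝓝[<] (1 : ℝ) ×ˢ 𝓝 x₀, p.1 < 1 :=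
  (tendsto_fst (f := 𝓝[<] (1 : ℝ)) (g := 𝓝 x₀)).eventually self_mem_nhdsWithin

theorem eventually_lt_re' (d : ℂ) {x₀ : ℂ} (hx₀ : 0 < x₀.re) (M : ℝ) :
    ∀ᶠ p : ℝ × ℂ in 𝓝[<] (1 : ℝ) ×ˢ 𝓝 x₀, M < (p.2 / (1 - p.1) + d).re := by
  filter_upwards [eventually_lt_re d hx₀ M, eventually_fst_lt_one] with p hp hp1
  have : 0 < 1 - p.1 := by linarith
  have : 0 ≤ x₀.re / 4 / (1 - p.1) := by positivity
  linarith

/-- For `a = 0` Euler's integral is `Γ(b)Γ(c-b)/Γ(c)`, and its scaling limit is `Γ(b) x^(-b)`;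
dividing gives the asymptotics without Stirling's formula. -/
theorem holLim_Gamma_add_div (d : ℂ) {b x₀ : ℂ} (hb : 0 < b.re) (hx₀ : 0 < x₀.re) :
    HolLim (𝓝[<] (1 : ℝ)) (fun ξ x => (1 - (ξ : ℂ)) ^ b *
      (Complex.Gamma (x / (1 - ξ) + (d + b)) / Complex.Gamma (x / (1 - ξ) + d)))
      (fun x => x ^ b) x₀ := by
  have hG := Complex.Gamma_ne_zero_of_re_pos hb
  have h := (HolLim.param (tendsto_const_nhds (x := Complex.Gamma b))).div
    (holLim_eulerIntegral 0 (d + b) hb hx₀) (by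
      rw [laplaceIntegral_zero hb hx₀]
      exact mul_ne_zero hG (cpow_ne_zero_of_ne_zero (ne_zero_of_re_pos hx₀) _))
  refine h.congr ?_ ?_
  · filter_upwards [eventually_lt_re' (d + b) hx₀ b.re] with p hp
    rw [eulerIntegral_zero _ hb hp, Complex.cpow_neg,
      show p.2 / (1 - p.1) + (d + b) - b = p.2 / (1 - p.1) + d by ring]
    field_simp
  · filter_upwards [eventually_re_pos hx₀] with x hx
    rw [laplaceIntegral_zero hb hx, Complex.cpow_neg]
    field_simp

theorem holLim_Gamma_div (α β : ℂ) {x₀ : ℂ} (hx₀ : 0 < x₀.re) :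
    HolLim (𝓝[<] (1 : ℝ)) (fun ξ x => (1 - (ξ : ℂ)) ^ (α - β) *
      (Complex.Gamma (x / (1 - ξ) + α) / Complex.Gamma (x / (1 - ξ) + β)))
      (fun x => x ^ (α - β)) x₀ := by
  -- Both Gamma functions are compared with `Γ(x/(1-ξ) - m)`, where `m` makes `α + m` and `β + m`
  -- admissible for the previous lemma.
  obtain ⟨m, hm⟩ := exists_nat_gt (max (-α.re) (-β.re))
  have hα : 0 < (α + m).re := by
    have := (le_max_left _ _).trans_lt hm
    simp; linarith
  have hβ : 0 < (β + m).re := by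
    have := (le_max_right _ _).trans_lt hm
    simp; linarith
  have h := (holLim_Gamma_add_div (-m) hα hx₀).div (holLim_Gamma_add_div (-m) hβ hx₀)
    (cpow_ne_zero_of_ne_zero (ne_zero_of_re_pos hx₀) _)
  refine h.congr ?_ ?_
  · filter_upwards [eventually_lt_re' (-m) hx₀ 0, eventually_fst_lt_one] with p hp hp1
    have h1 := Complex.Gamma_ne_zero_of_re_pos hp
    have h2 := one_sub_ne_zero_of_lt hp1
    rw [show -(m : ℂ) + (α + m) = α by ring, show -(m : ℂ) + (β + m) = β by ring,
      show α - β = (α + m) - (β + m) by ring, Complex.cpow_sub _ _ h2]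
    rw [mul_div_mul_comm, div_div_div_cancel_right₀ h1]
  · filter_upwards [eventually_re_pos hx₀] with x hx
    rw [show α - β = (α + m) - (β + m) by ring, Complex.cpow_sub _ _ (ne_zero_of_re_pos hx)]

/-! ### Confluent limits of the hypergeometric function for all parameters -/

/-- `G` is the limit of the hypergeometric functions `F(a, b; x/(1-ξ) + d; ξ/(ξ-1))` as `ξ → 1`. -/
structure GaussLimit (a b : ℂ) (G : ℂ → ℂ) : Prop where
  holLim : ∀ d x₀ : ℂ, 0 < x₀.re → HolLim (𝓝[<] (1 : ℝ))
    (fun ξ x => gaussF a b (x / (1 - ξ) + d) (ξ / (ξ - 1))) G x₀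
  tendsto_one : Tendsto (fun x : ℝ => G x) atTop (𝓝 1)

/-- The normalized Laplace integral. -/
def laplaceG (a b x : ℂ) : ℂ := x ^ b / Complex.Gamma b * laplaceIntegral a b x

theorem gaussLimit_laplaceG (a : ℂ) {b : ℂ} (hb : 0 < b.re) : GaussLimit a b (laplaceG a b) where
  holLim d x₀ hx₀ := by
    have h := ((holLim_Gamma_add_div (d - b) hb hx₀).div
      (HolLim.param (tendsto_const_nhds (x := Complex.Gamma b)))
      (Complex.Gamma_ne_zero_of_re_pos hb)).mul (holLim_eulerIntegral a d hb hx₀)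
    refine h.congr ?_ .rfl
    filter_upwards [eventually_lt_re' d hx₀ b.re, eventually_fst_lt_one,
      (tendsto_fst (f := 𝓝[<] (1 : ℝ)) (g := 𝓝 x₀)).eventually eventually_mem_Ioo] with p hp hp1 hp2
    have h2 := cpow_ne_zero_of_ne_zero (one_sub_ne_zero_of_lt hp1) b
    have h3 := Complex.Gamma_ne_zero_of_re_pos (s := p.2 / (1 - p.1) + (d - b)) (by
      rw [← add_sub_assoc]; simpa using hp)
    have h4 := Complex.Gamma_ne_zero_of_re_pos hb
    rw [(gaussF_eq_eulerIntegral a hb hp).2 _ (re_div_sub_one_lt hp2), Complex.cpow_neg,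
      sub_add_cancel, add_sub_assoc]
    field_simp
  tendsto_one := by
    have h := (tendsto_laplaceIntegral_atTop a hb).div_const (Complex.Gamma b)
    rw [div_self (Complex.Gamma_ne_zero_of_re_pos hb)] at h
    refine h.congr fun x => ?_
    rw [laplaceG]
    ring

theorem GaussLimit.unique {a b : ℂ} {G H : ℂ → ℂ} (hG : GaussLimit a b G) (hH : GaussLimit a b H)
    {x : ℂ} (hx : 0 < x.re) : G x = H x :=
  tendsto_nhds_unique (hG.holLim 0 x hx).tendsto (hH.holLim 0 x hx).tendsto

/-- Multiply the contiguous relation by `1 - ξ`: then `(1-ξ)c → x`, `(1-ξ)w = -ξ → -1` and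
`(1-ξ)(1-w) = 1`. The limit relation is solved for the `b - 1` term, as `x ≠ 0`. -/
theorem GaussLimit.sub_one {a b : ℂ} {G H : ℂ → ℂ} (hG : GaussLimit a b G)
    (hH : GaussLimit a (b + 1) H) :
    GaussLimit a (b - 1) fun x => ((x + (a - b)) * G x + b * H x) / x where
  holLim d x₀ hx₀ := by
    have hξ : Tendsto (fun ξ : ℝ => (ξ : ℂ)) (𝓝[<] 1) (𝓝 1) := by
      have := (Complex.continuous_ofReal.tendsto 1).mono_left
        (nhdsWithin_le_nhds (s := Iio (1 : ℝ)))
      simpa using this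
    have hid : HolLim (𝓝[<] (1 : ℝ)) (fun _ x => x) (fun x => x) x₀ :=
      HolLim.fixed (.of_forall fun _ => differentiableAt_id)
    have e1 : Tendsto (fun ξ : ℝ => (1 - (ξ : ℂ)) * (d - 2 * b) + (a - b) * ξ) (𝓝[<] 1)
        (𝓝 (a - b)) := by
      have := ((hξ.const_sub 1).mul_const (d - 2 * b)).add (hξ.const_mul (a - b))
      simpa using this
    have e2 : Tendsto (fun ξ : ℝ => (1 - (ξ : ℂ)) * (d - b)) (𝓝[<] 1) (𝓝 0) := by
      have := (hξ.const_sub 1).mul_const (d - b)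
      simpa using this
    have h := (((hid.add (HolLim.param e1)).mul (hG.holLim d x₀ hx₀)).add
      ((HolLim.param (tendsto_const_nhds (x := b))).mul (hH.holLim d x₀ hx₀))).div
      (hid.add (HolLim.param e2)) (by simpa using ne_zero_of_re_pos hx₀)
    simp only [add_zero] at h
    refine h.congr ?_ .rfl
    -- One `n` serves `b - 1`, `b` and `b + 1` in `gaussRegular_of_re`; the margin `|re b| + 1 + 2n`
    -- for `re c` covers the largest of the three.
    obtain ⟨n, hn⟩ := exists_nat_gt (-(b.re - 1))
    filter_upwards [eventually_lt_re' d hx₀ (|b.re| + 1 + 2 * n), eventually_fst_lt_one,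
      (tendsto_fst (f := 𝓝[<] (1 : ℝ)) (g := 𝓝 x₀)).eventually eventually_mem_Ioo] with p hp hp1 hp2
    have hn0 : (0 : ℝ) ≤ n := n.cast_nonneg
    have habs := le_abs_self b.re
    have habs0 := abs_nonneg b.re
    have hc : 0 < (p.2 / (1 - p.1) + d).re := by linarith
    have hR : ∀ b' : ℂ, b.re - 1 ≤ b'.re → b'.re ≤ b.re + 1 →
        GaussRegular a b' (p.2 / (1 - p.1) + d) := fun b' h1 h2 =>
      gaussRegular_of_re a n (by linarith) hc (by linarith)
    have key := gaussF_contiguous hc (hR (b - 1) (by simp) (by simp; linarith))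
      (hR b (by linarith) (by linarith)) (hR (b + 1) (by simp; linarith) (by simp))
      (re_div_sub_one_lt hp2)
    have h0 := one_sub_ne_zero_of_lt hp1
    have h0' : (p.1 : ℂ) - 1 ≠ 0 := by rw [← neg_sub]; exact neg_ne_zero.2 h0
    have hcb : p.2 / (1 - p.1) + d - b ≠ 0 := by
      refine ne_zero_of_re_pos ?_
      rw [Complex.sub_re]; linarith
    have hden : p.2 + (1 - (p.1 : ℂ)) * (d - b) = (1 - p.1) * (p.2 / (1 - p.1) + d - b) := by
      field_simp
      ring
    have hw : (1 - (p.1 : ℂ)) * (p.1 / (p.1 - 1)) = -p.1 := by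
      field_simp
      ring
    have hx : (1 - (p.1 : ℂ)) * (p.2 / (1 - p.1)) = p.2 := by
      field_simp
    rw [hden, eq_div_iff (mul_ne_zero h0 hcb)]
    set F₁ := gaussF a (b - 1) (p.2 / (1 - p.1) + d) (p.1 / (p.1 - 1))
    set F₂ := gaussF a b (p.2 / (1 - p.1) + d) (p.1 / (p.1 - 1))
    set F₃ := gaussF a (b + 1) (p.2 / (1 - p.1) + d) (p.1 / (p.1 - 1))
    linear_combination (1 - (p.1 : ℂ)) * key + (-(a - b) * F₂ - b * F₃) * hw + F₂ * hx
  tendsto_one := by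
    have hinv : Tendsto (fun x : ℝ => ((x : ℂ))⁻¹) atTop (𝓝 0) := by
      have := (Complex.continuous_ofReal.tendsto _).comp tendsto_inv_atTop_zero
      simpa [Function.comp_def] using this
    have h := (((hinv.const_mul (a - b)).const_add 1).mul hG.tendsto_one).add
      ((hinv.const_mul b).mul hH.tendsto_one)
    simp only [mul_zero, add_zero, mul_one] at h
    refine h.congr' ?_
    filter_upwards [eventually_gt_atTop 0] with x hx
    have : (x : ℂ) ≠ 0 := by exact_mod_cast hx.ne'
    field_simp

/-- Limits for the parameters `b` and `b + 1`, with the differential equations they satisfy. -/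
structure GaussLimitPair (a b : ℂ) (G H : ℂ → ℂ) : Prop where
  left : GaussLimit a b G
  right : GaussLimit a (b + 1) H
  deriv_left : ∀ x : ℂ, 0 < x.re → HasDerivAt G (b / x * (G x - H x)) x
  deriv_right : ∀ x : ℂ, 0 < x.re → HasDerivAt H ((1 + a / x) * H x - G x) x

theorem hasDerivAt_laplaceG (a : ℂ) {b x : ℂ} (hb : 0 < b.re) (hx : 0 < x.re) :
    HasDerivAt (laplaceG a b) (b / x * (laplaceG a b x - laplaceG a (b + 1) x)) x := by
  have h1 : HasDerivAt (fun x : ℂ => x ^ b) (b * x ^ (b - 1) * 1) x :=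
    (hasDerivAt_id x).cpow_const (Or.inl hx)
  have h2 := (h1.div_const (Complex.Gamma b)).mul (hasDerivAt_laplaceIntegral a hb hx)
  refine h2.congr_deriv ?_
  have hx0 := ne_zero_of_re_pos hx
  have hb0 := ne_zero_of_re_pos hb
  have hG := Complex.Gamma_ne_zero_of_re_pos hb
  rw [laplaceG, laplaceG, Complex.Gamma_add_one _ hb0, Complex.cpow_add _ _ hx0,
    Complex.cpow_sub _ _ hx0, Complex.cpow_one]
  field_simp
  ring

/-- The derivative for `b + 1` involves `b + 2`. Uniqueness of limits identifies the function for
`b` with the combination in `GaussLimit.sub_one`, which eliminates `b + 2` and closes the system. -/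
theorem gaussLimitPair_laplaceG (a : ℂ) {b : ℂ} (hb : 0 < b.re) :
    GaussLimitPair a b (laplaceG a b) (laplaceG a (b + 1)) where
  left := gaussLimit_laplaceG a hb
  right := gaussLimit_laplaceG a (by simp; positivity)
  deriv_left x hx := hasDerivAt_laplaceG a hb hx
  deriv_right x hx := by
    have hb1 : 0 < (b + 1).re := by simp; positivity
    have hb2 : 0 < (b + 1 + 1).re := by simp; positivity
    refine (hasDerivAt_laplaceG a hb1 hx).congr_deriv ?_
    have h := (gaussLimit_laplaceG a hb1).sub_one (gaussLimit_laplaceG a hb2)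
    rw [add_sub_cancel_right] at h
    rw [(gaussLimit_laplaceG a hb).unique h hx]
    have hx0 := ne_zero_of_re_pos hx
    field_simp
    ring

theorem GaussLimitPair.sub_one {a b : ℂ} {G H : ℂ → ℂ} (h : GaussLimitPair a b G H) :
    GaussLimitPair a (b - 1) (fun x => ((x + (a - b)) * G x + b * H x) / x) G where
  left := h.left.sub_one h.right
  right := by rw [sub_add_cancel]; exact h.left
  deriv_left x hx := by
    have hx0 := ne_zero_of_re_pos hx
    have h1 := ((((hasDerivAt_id x).add_const (a - b)).mul (h.deriv_left x hx)).add
      ((h.deriv_right x hx).const_mul b)).div (hasDerivAt_id x) hx0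
    refine h1.congr_deriv ?_
    simp only [id, Pi.add_apply, Pi.mul_apply]
    field_simp
    ring
  deriv_right x hx := by
    have hx0 := ne_zero_of_re_pos hx
    refine (h.deriv_left x hx).congr_deriv ?_
    field_simp
    ring

theorem exists_gaussLimitPair (a b : ℂ) : ∃ G H, GaussLimitPair a b G H := by
  obtain ⟨n, hn⟩ := exists_nat_gt (-b.re)
  induction n generalizing b with
  | zero => exact ⟨_, _, gaussLimitPair_laplaceG a (by simpa using hn)⟩
  | succ n ih =>
    obtain ⟨G, H, h⟩ := ih (b + 1) (by push_cast at hn; simp; linarith)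
    have := h.sub_one
    rw [add_sub_cancel_right] at this
    exact ⟨_, _, this⟩

/-! ### Uniqueness of the Whittaker function and its identification -/

/-- If a function and its second derivative tend to zero at infinity, so does the first
derivative. -/
theorem tendsto_deriv_zero_of_second {y y' y'' : ℝ → ℂ}
    (hy : ∀ x, 0 < x → HasDerivAt y (y' x) x) (hy' : ∀ x, 0 < x → HasDerivAt y' (y'' x) x)
    (h0 : Tendsto y atTop (𝓝 0)) (h2 : Tendsto y'' atTop (𝓝 0)) : Tendsto y' atTop (𝓝 0) := by
  rw [Metric.tendsto_atTop] at h0 h2 ⊢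
  intro ε hε
  obtain ⟨A, hA⟩ := h0 (ε / 3) (by positivity)
  obtain ⟨B, hB⟩ := h2 (ε / 3) (by positivity)
  refine ⟨max 1 (max A B), fun x hx => ?_⟩
  have hx1 : 1 ≤ x := (le_max_left _ _).trans hx
  have hxA : A ≤ x := ((le_max_left _ _).trans (le_max_right _ _)).trans hx
  have hxB : B ≤ x := ((le_max_right _ _).trans (le_max_right _ _)).trans hx
  simp only [dist_zero_right] at hA hB ⊢
  -- On an interval of length one `y'` is almost constant, so `y' x` is `y (x + 1) - y x` up to `ε /
  -- 3`.
  have hd : ∀ t ∈ Icc x (x + 1), ‖y' t - y' x‖ ≤ ε / 3 := by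
    intro t ht
    have h := (convex_Icc x (x + 1)).norm_image_sub_le_of_norm_hasDerivWithin_le (f := y')
      (f' := y'') (C := ε / 3) (fun s hs => (hy' s (by linarith [hs.1])).hasDerivWithinAt)
      (fun s hs => (hB s (hxB.trans hs.1)).le) (left_mem_Icc.2 (by linarith)) ht
    refine h.trans ?_
    rw [Real.norm_of_nonneg (by linarith [ht.1])]
    nlinarith [ht.2]
  have h := (convex_Icc x (x + 1)).norm_image_sub_le_of_norm_hasDerivWithin_le
      (f := fun t => y t - (t : ℂ) * y' x)
      (f' := fun t => y' t - y' x) (C := ε / 3)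
      (fun s hs => by
        have h1 : HasDerivAt (fun t : ℝ => (t : ℂ) * y' x) (1 * y' x) s :=
          (Complex.ofRealCLM.hasDerivAt (x := s)).mul_const (y' x)
        rw [one_mul] at h1
        exact ((hy s (by linarith [hs.1])).sub h1).hasDerivWithinAt)
      hd (left_mem_Icc.2 (by linarith)) (right_mem_Icc.2 (by linarith))
  have e : y' x = y (x + 1) - y x -
      (y (x + 1) - ((x + 1 : ℝ) : ℂ) * y' x - (y x - (x : ℂ) * y' x)) := by
    push_cast
    ring
  have h3 := hA (x + 1) (by linarith)
  have h4 := hA x hxA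
  rw [add_sub_cancel_left, norm_one, mul_one] at h
  rw [e]
  have := norm_sub_le (y (x + 1) - y x)
    (y (x + 1) - ((x + 1 : ℝ) : ℂ) * y' x - (y x - (x : ℂ) * y' x))
  have := norm_sub_le (y (x + 1)) (y x)
  linarith

theorem tendsto_cpow_mul_exp_neg_half (κ : ℂ) :
    Tendsto (fun x : ℝ => (x : ℂ) ^ κ * Complex.exp (-(x : ℂ) / 2)) atTop (𝓝 0) := by
  rw [tendsto_zero_iff_norm_tendsto_zero]
  refine (tendsto_rpow_mul_exp_neg_mul_atTop_nhds_zero κ.re (1 / 2) (by norm_num)).congr' ?_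
  filter_upwards [eventually_gt_atTop 0] with x hx
  rw [norm_mul, Complex.norm_cpow_eq_rpow_re_of_pos hx, Complex.norm_exp]
  congr 2
  simp
  ring

/-- The coefficient of the Whittaker equation. -/
def whittakerCoeff (κ μ : ℂ) (x : ℝ) : ℂ := 1 / 4 - κ / (x : ℂ) + (μ ^ 2 - 1 / 4) / (x : ℂ) ^ 2

theorem tendsto_whittakerCoeff (κ μ : ℂ) :
    Tendsto (whittakerCoeff κ μ) atTop (𝓝 (1 / 4)) := by
  have hinv : Tendsto (fun x : ℝ => ((x : ℂ))⁻¹) atTop (𝓝 0) := by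
    have := (Complex.continuous_ofReal.tendsto _).comp tendsto_inv_atTop_zero
    simpa [Function.comp_def] using this
  have h := ((hinv.const_mul κ).const_sub (1 / 4)).add ((hinv.pow 2).const_mul (μ ^ 2 - 1 / 4))
  simp only [mul_zero, sub_zero, ne_eq, OfNat.ofNat_ne_zero, not_false_eq_true, zero_pow,
    add_zero] at h
  refine h.congr fun x => ?_
  simp only [whittakerCoeff, div_eq_mul_inv, inv_pow]

/-- Both solutions decay with their derivatives, so their constant Wronskian is `0`. Hence `y₂ / y₁`
is constant near infinity, and equal to `1` by the common asymptotics; uniqueness for the equation,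
solved backwards, gives the rest of `(0, ∞)`. -/
theorem IsWhittaker.eqOn {κ μ : ℂ} {y₁ y₂ : ℝ → ℂ} (h₁ : IsWhittaker κ μ y₁)
    (h₂ : IsWhittaker κ μ y₂) : EqOn y₁ y₂ (Ioi 0) := by
  obtain ⟨⟨y₁', hd₁⟩, ha₁⟩ := h₁
  obtain ⟨⟨y₂', hd₂⟩, ha₂⟩ := h₂
  change ∀ x : ℝ, 0 < x → HasDerivAt y₁ (y₁' x) x ∧
    HasDerivAt y₁' (whittakerCoeff κ μ x * y₁ x) x at hd₁
  change ∀ x : ℝ, 0 < x → HasDerivAt y₂ (y₂' x) x ∧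
    HasDerivAt y₂' (whittakerCoeff κ μ x * y₂ x) x at hd₂
  have t₁ : Tendsto y₁ atTop (𝓝 0) := ha₁.symm.tendsto_nhds (tendsto_cpow_mul_exp_neg_half κ)
  have t₂ : Tendsto y₂ atTop (𝓝 0) := ha₂.symm.tendsto_nhds (tendsto_cpow_mul_exp_neg_half κ)
  have t₁' : Tendsto y₁' atTop (𝓝 0) :=
    tendsto_deriv_zero_of_second (fun x hx => (hd₁ x hx).1) (fun x hx => (hd₁ x hx).2) t₁
      (by simpa using (tendsto_whittakerCoeff κ μ).mul t₁)
  have t₂' : Tendsto y₂' atTop (𝓝 0) :=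
    tendsto_deriv_zero_of_second (fun x hx => (hd₂ x hx).1) (fun x hx => (hd₂ x hx).2) t₂
      (by simpa using (tendsto_whittakerCoeff κ μ).mul t₂)
  have hW : ∀ x : ℝ, 0 < x → y₁ x * y₂' x - y₁' x * y₂ x = 0 := by
    intro x hx
    have hconst : ∀ t : ℝ, x ≤ t → y₁ t * y₂' t - y₁' t * y₂ t = y₁ x * y₂' x - y₁' x * y₂ x := by
      intro t ht
      have h := (convex_Ici x).norm_image_sub_le_of_norm_hasDerivWithin_le
        (f := fun t => y₁ t * y₂' t - y₁' t * y₂ t) (f' := fun _ => 0) (C := 0)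
        (fun s hs => by
          have hs0 : 0 < s := hx.trans_le hs
          refine ((((hd₁ s hs0).1.mul (hd₂ s hs0).2).sub
            ((hd₁ s hs0).2.mul (hd₂ s hs0).1)).congr_deriv ?_).hasDerivWithinAt
          ring) (by simp) (mem_Ici.2 le_rfl) ht
      rw [zero_mul] at h
      exact sub_eq_zero.1 (norm_le_zero_iff.1 h)
    have hlim : Tendsto (fun t => y₁ t * y₂' t - y₁' t * y₂ t) atTop (𝓝 0) := by
      simpa using (t₁.mul t₂').sub (t₁'.mul t₂)
    refine tendsto_nhds_unique (Tendsto.congr' ?_ tendsto_const_nhds) hlim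
    filter_upwards [eventually_ge_atTop x] with t ht
    exact (hconst t ht).symm
  have hne : ∀ᶠ x : ℝ in atTop, y₁ x ≠ 0 := by
    have hg : ∀ᶠ x : ℝ in atTop, (x : ℂ) ^ κ * Complex.exp (-(x : ℂ) / 2) ≠ 0 := by
      filter_upwards [eventually_gt_atTop 0] with x hx
      have : (x : ℂ) ≠ 0 := by exact_mod_cast hx.ne'
      exact mul_ne_zero (cpow_ne_zero_of_ne_zero this _) (Complex.exp_ne_zero _)
    obtain ⟨φ, hφ, hφe⟩ := ha₁.exists_eq_mul
    filter_upwards [hg, hφe, hφ.eventually_ne one_ne_zero] with x h1 h2 h3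
    rw [h2]
    exact mul_ne_zero h3 h1
  obtain ⟨X, hX⟩ := eventually_atTop.1 (hne.and (eventually_gt_atTop 0))
  have heq : ∀ x : ℝ, X ≤ x → y₁ x = y₂ x := by
    intro x hx
    have hconst : ∀ t : ℝ, x ≤ t → y₂ t / y₁ t = y₂ x / y₁ x := by
      intro t ht
      have h := (convex_Ici x).norm_image_sub_le_of_norm_hasDerivWithin_le
        (f := fun t => y₂ t / y₁ t) (f' := fun _ => 0) (C := 0)
        (fun s hs => by
          obtain ⟨hs1, hs0⟩ := hX s (hx.trans hs)
          refine (((hd₂ s hs0).1.div (hd₁ s hs0).1 hs1).congr_deriv ?_).hasDerivWithinAt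
          rw [div_eq_zero_iff]
          left
          linear_combination hW s hs0) (by simp) (mem_Ici.2 le_rfl) ht
      rw [zero_mul] at h
      exact sub_eq_zero.1 (norm_le_zero_iff.1 h)
    have hlim : Tendsto (fun t => y₂ t / y₁ t) atTop (𝓝 1) :=
      (isEquivalent_iff_tendsto_one hne).1 (ha₂.trans ha₁.symm)
    have h1 : y₂ x / y₁ x = 1 := by
      refine tendsto_nhds_unique (Tendsto.congr' ?_ tendsto_const_nhds) hlim
      filter_upwards [eventually_ge_atTop x] with t ht
      exact (hconst t ht).symm
    rw [div_eq_one_iff_eq (hX x hx).1] at h1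
    exact h1.symm
  intro x hx
  have hx : 0 < x := hx
  rcases le_or_gt X x with h | h
  · exact heq x h
  have hpos : ∀ t ∈ Icc x (X + 1), 0 < t := fun t ht => hx.trans_le ht.1
  obtain ⟨M, hM⟩ := (isCompact_Icc (a := x) (b := X + 1)).exists_bound_of_continuousOn
    (f := whittakerCoeff κ μ) (by
      intro t ht
      have h0 : (t : ℂ) ≠ 0 := by exact_mod_cast (hpos t ht).ne'
      unfold whittakerCoeff
      refine ContinuousAt.continuousWithinAt ?_
      fun_prop (disch := simpa using h0))
  have hlip : ∀ t ∈ Ioc x (X + 1), LipschitzOnWith (Real.toNNReal (max 1 M))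
      (fun p : ℂ × ℂ => (p.2, whittakerCoeff κ μ t * p.1)) univ := by
    intro t ht
    refine LipschitzWith.lipschitzOnWith (LipschitzWith.of_dist_le_mul fun p q => ?_)
    rw [Real.coe_toNNReal _ (by positivity), Prod.dist_eq, Prod.dist_eq]
    have hm : 0 ≤ max (dist p.1 q.1) (dist p.2 q.2) := le_max_of_le_left dist_nonneg
    refine max_le ?_ ?_
    · calc dist p.2 q.2 ≤ 1 * max (dist p.1 q.1) (dist p.2 q.2) := by
            rw [one_mul]; exact le_max_right _ _
        _ ≤ _ := by gcongr; exact le_max_left _ _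
    · simp only [dist_eq_norm, ← mul_sub, norm_mul] at hm ⊢
      have := (hM t (Ioc_subset_Icc_self ht)).trans (le_max_right 1 M)
      gcongr
      exact le_max_left _ _
  have hder : ∀ {y y' : ℝ → ℂ}, (∀ x : ℝ, 0 < x → HasDerivAt y (y' x) x ∧
      HasDerivAt y' (whittakerCoeff κ μ x * y x) x) → ∀ t ∈ Icc x (X + 1),
      HasDerivAt (fun t => (y t, y' t)) (y' t, whittakerCoeff κ μ t * y t) t :=
    fun hd t ht => (hd t (hpos t ht)).1.prodMk (hd t (hpos t ht)).2
  -- The backward problem starts at `X + 1` rather than `X`, since agreement of derivatives needs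
  -- agreement on a neighbourhood.
  have hX1 : y₁' (X + 1) = y₂' (X + 1) := by
    have hX0 : 0 < X + 1 := by linarith [(hX X le_rfl).2]
    refine (hd₁ _ hX0).1.unique ((hd₂ _ hX0).1.congr_of_eventuallyEq ?_)
    filter_upwards [lt_mem_nhds (show X < X + 1 by linarith)] with t ht
    exact heq t ht.le
  have := ODE_solution_unique_of_mem_Icc_left (s := fun _ => univ)
    (v := fun t (p : ℂ × ℂ) => (p.2, whittakerCoeff κ μ t * p.1))
    (f := fun t => (y₁ t, y₁' t)) (g := fun t => (y₂ t, y₂' t)) hlip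
    (fun t ht => (hder hd₁ t ht).continuousAt.continuousWithinAt)
    (fun t ht => (hder hd₁ t (Ioc_subset_Icc_self ht)).hasDerivWithinAt) (fun _ _ => mem_univ _)
    (fun t ht => (hder hd₂ t ht).continuousAt.continuousWithinAt)
    (fun t ht => (hder hd₂ t (Ioc_subset_Icc_self ht)).hasDerivWithinAt) (fun _ _ => mem_univ _)
    (by simp only [heq (X + 1) (by linarith), hX1]) (left_mem_Icc.2 (by linarith))
  exact congrArg Prod.fst this

theorem IsWhittaker.whittakerW_eq {κ μ : ℂ} {y : ℝ → ℂ} (h : IsWhittaker κ μ y) {x : ℝ}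
    (hx : 0 < x) : whittakerW κ μ x = y x := by
  have h' : ∃ y, IsWhittaker κ μ y := ⟨y, h⟩
  rw [whittakerW, dif_pos h']
  exact h'.choose_spec.eqOn h hx

/-- The first-order system amounts to a second-order equation for `G`, which the factor `x^κ
e^(-x/2)` brings to Whittaker form; `G → 1` is the normalization. Only `μ ^ 2` is prescribed,
because the sign of `μ` does not enter the equation. -/
theorem GaussLimitPair.isWhittaker {a b κ μ : ℂ} {G H : ℂ → ℂ} (h : GaussLimitPair a b G H)
    (hκ : κ = (1 - a - b) / 2) (hμ : μ ^ 2 = ((b - a) / 2) ^ 2) :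
    IsWhittaker κ μ fun x : ℝ => (x : ℂ) ^ κ * Complex.exp (-(x : ℂ) / 2) * G x := by
  have hρ : ∀ x : ℂ, 0 < x.re → HasDerivAt (fun x : ℂ => x ^ κ * Complex.exp (-x / 2))
      ((κ / x - 1 / 2) * (x ^ κ * Complex.exp (-x / 2))) x := by
    intro x hx
    have hx0 := ne_zero_of_re_pos hx
    have h1 : HasDerivAt (fun x : ℂ => x ^ κ) (κ * x ^ (κ - 1) * 1) x :=
      (hasDerivAt_id x).cpow_const (Or.inl hx)
    have h2 : HasDerivAt (fun x : ℂ => Complex.exp (-x / 2)) (Complex.exp (-x / 2) * (-1 / 2)) x :=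
      ((hasDerivAt_neg x).div_const 2).cexp
    refine (h1.mul h2).congr_deriv ?_
    rw [Complex.cpow_sub _ _ hx0, Complex.cpow_one]
    field_simp
    ring
  refine ⟨⟨fun x : ℝ => (x : ℂ) ^ κ * Complex.exp (-(x : ℂ) / 2) *
    ((κ / x - 1 / 2) * G x + b / x * (G x - H x)), fun x hx => ?_⟩, ?_⟩
  · have hx' : 0 < ((x : ℂ)).re := by simpa using hx
    have hx0 := ne_zero_of_re_pos hx'
    have hG := h.deriv_left x hx'
    have hH := h.deriv_right x hx'
    have hinv : ∀ k : ℂ, HasDerivAt (fun x : ℂ => k / x) (-k / (x : ℂ) ^ 2) x := fun k => by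
      have := (hasDerivAt_inv hx0).const_mul k
      simp only [← div_eq_mul_inv] at this
      refine this.congr_deriv ?_
      ring
    refine ⟨?_, ?_⟩
    · refine (((hρ x hx').mul hG).congr_deriv ?_).comp_ofReal
      ring
    · refine (((hρ x hx').mul ((((hinv κ).sub_const (1 / 2)).mul hG).add
        ((hinv b).mul (hG.sub hH)))).congr_deriv ?_).comp_ofReal
      simp only [Pi.add_apply, Pi.mul_apply, Pi.sub_apply]
      rw [hμ, hκ]
      field_simp
      ring
  · have hne : ∀ᶠ x : ℝ in atTop, (x : ℂ) ^ κ * Complex.exp (-(x : ℂ) / 2) ≠ 0 := by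
      filter_upwards [eventually_gt_atTop 0] with x hx
      have : (x : ℂ) ≠ 0 := by exact_mod_cast hx.ne'
      exact mul_ne_zero (cpow_ne_zero_of_ne_zero this _) (Complex.exp_ne_zero _)
    rw [isEquivalent_iff_tendsto_one hne]
    refine h.left.tendsto_one.congr' ?_
    filter_upwards [hne] with x hx
    simp only [Pi.div_apply]
    rw [mul_div_cancel_left₀ _ hx]

/-! ### Reality and positivity from admissibility -/

/-- With `t = zz'`, the case `k = 2` reads `t (t + (z + z') + 1) = q`, which determines `z + z'` as
a real number. -/
theorem Admissible.exists_real {z z' : ℂ} (hz : Admissible z z') :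
    ∃ t r : ℝ, 0 < t ∧ z * z' = t ∧ z + z' = r := by
  obtain ⟨t, ht, e1⟩ := (hz 1 le_rfl).1
  obtain ⟨q, -, e2⟩ := (hz 2 (by norm_num)).1
  have e1 : z * z' = t := by simpa using e1
  have e2 : z * (z + 1) * (z' * (z' + 1)) = q := by
    have h : ∀ w : ℂ, (ascPochhammer ℂ 2).eval w = w * (w + 1) := fun w => by
      rw [show (2 : ℕ) = 1 + 1 from rfl, ascPochhammer_succ_eval]
      simp
    rw [← e2, h, h]
  refine ⟨t, q / t - t - 1, ht, e1, ?_⟩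
  have ht0 : (t : ℂ) ≠ 0 := by exact_mod_cast ht.ne'
  push_cast
  rw [← e2, ← e1]
  rw [← e1] at ht0
  have hz0 := left_ne_zero_of_mul ht0
  have hz0' := right_ne_zero_of_mul ht0
  field_simp
  ring

theorem ascPochhammer_eval_eq_prod (w : ℂ) (n : ℕ) :
    (ascPochhammer ℂ n).eval w = ∏ j ∈ Finset.range n, (w + j) := by
  induction n with
  | zero => simp
  | succ n ih => rw [ascPochhammer_succ_eval, Finset.prod_range_succ, ih]

theorem prod_range_one_add {w : ℂ} (hw : w ≠ 0) (n : ℕ) :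
    ∏ j ∈ Finset.range (n + 1), (1 + w + j) = (ascPochhammer ℂ (n + 2)).eval w / w := by
  rw [eq_div_iff hw, ascPochhammer_succ_left, mul_comm]
  simp only [Polynomial.eval_mul, Polynomial.eval_X, Polynomial.eval_comp, Polynomial.eval_add,
    Polynomial.eval_one]
  rw [ascPochhammer_eval_eq_prod, add_comm w 1]

/-- In Euler's limit formula the product of the `n`-th approximants is `n^(2+w+w') n!² ww' /
((w)_(n+2) (w')_(n+2)) > 0`, so the limit is real and nonnegative. It is nonzero because Gamma has
no zeros and nonvanishing Pochhammer symbols exclude the poles. -/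
theorem Gamma_mul_Gamma_pos {w w' : ℂ}
    (h : ∀ k : ℕ, 1 ≤ k → ∃ r : ℝ, 0 < r ∧
      (ascPochhammer ℂ k).eval w * (ascPochhammer ℂ k).eval w' = (r : ℂ))
    {r : ℝ} (hr : w + w' = r) :
    ∃ γ : ℝ, 0 < γ ∧ Complex.Gamma (1 + w) * Complex.Gamma (1 + w') = γ := by
  obtain ⟨t, ht, e1⟩ := h 1 le_rfl
  have e1 : w * w' = t := by simpa using e1
  have hww : w * w' ≠ 0 := by rw [e1]; exact_mod_cast ht.ne'
  have hw := left_ne_zero_of_mul hww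
  have hw' := right_ne_zero_of_mul hww
  have hseq : ∀ n : ℕ, 1 ≤ n → ∃ q : ℝ, 0 < q ∧
      Complex.GammaSeq (1 + w) n * Complex.GammaSeq (1 + w') n = q := by
    intro n hn
    obtain ⟨p, hp, e2⟩ := h (n + 2) (by omega)
    have hn0 : (0 : ℝ) < n := by exact_mod_cast hn
    have hnc : (n : ℂ) ≠ 0 := by exact_mod_cast hn0.ne'
    refine ⟨(n : ℝ) ^ (2 + r) * (n.factorial : ℝ) ^ 2 * t / p, by positivity, ?_⟩
    rw [Complex.GammaSeq, Complex.GammaSeq, prod_range_one_add hw, prod_range_one_add hw']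
    push_cast
    rw [Complex.ofReal_cpow hn0.le]
    push_cast
    rw [← hr, ← e1, ← e2, show (2 : ℂ) + (w + w') = (1 + w) + (1 + w') by ring,
      Complex.cpow_add (1 + w) (1 + w') hnc]
    generalize (n : ℂ) ^ (1 + w) = A
    generalize (n : ℂ) ^ (1 + w') = B
    have h0 : (ascPochhammer ℂ (n + 2)).eval w * (ascPochhammer ℂ (n + 2)).eval w' ≠ 0 := by
      rw [e2]; exact_mod_cast hp.ne'
    have h1 := left_ne_zero_of_mul h0
    have h2 := right_ne_zero_of_mul h0
    field_simp
  have hlim := (Complex.GammaSeq_tendsto_Gamma (1 + w)).mul (Complex.GammaSeq_tendsto_Gamma (1 + w'))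
  have him : (Complex.Gamma (1 + w) * Complex.Gamma (1 + w')).im = 0 := by
    refine tendsto_nhds_unique ((Complex.continuous_im.tendsto _).comp hlim)
      (Tendsto.congr' ?_ tendsto_const_nhds)
    filter_upwards [eventually_ge_atTop 1] with n hn
    obtain ⟨q, -, e⟩ := hseq n hn
    simp only [Function.comp]
    rw [e, Complex.ofReal_im]
  have hre : 0 ≤ (Complex.Gamma (1 + w) * Complex.Gamma (1 + w')).re := by
    refine ge_of_tendsto ((Complex.continuous_re.tendsto _).comp hlim) ?_
    filter_upwards [eventually_ge_atTop 1] with n hn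
    obtain ⟨q, hq, e⟩ := hseq n hn
    simp only [Function.comp]
    rw [e, Complex.ofReal_re]
    exact hq.le
  have hne : Complex.Gamma (1 + w) * Complex.Gamma (1 + w') ≠ 0 := by
    have hpoch : ∀ m : ℕ, (ascPochhammer ℂ (m + 2)).eval w ≠ 0 ∧
        (ascPochhammer ℂ (m + 2)).eval w' ≠ 0 := by
      intro m
      obtain ⟨p, hp, e2⟩ := h (m + 2) (by omega)
      have h0 : (ascPochhammer ℂ (m + 2)).eval w * (ascPochhammer ℂ (m + 2)).eval w' ≠ 0 := by
        rw [e2]; exact_mod_cast hp.ne'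
      exact ⟨left_ne_zero_of_mul h0, right_ne_zero_of_mul h0⟩
    refine mul_ne_zero (Complex.Gamma_ne_zero fun m hm => (hpoch m).1 ?_)
      (Complex.Gamma_ne_zero fun m hm => (hpoch m).2 ?_)
    all_goals
      rw [ascPochhammer_eval_eq_zero_iff]
      refine ⟨m + 1, by omega, ?_⟩
      push_cast
      linear_combination hm
  have e : Complex.Gamma (1 + w) * Complex.Gamma (1 + w') =
      ((Complex.Gamma (1 + w) * Complex.Gamma (1 + w')).re : ℂ) :=
    Complex.ext (by simp) (by simp [him])
  refine ⟨_, lt_of_le_of_ne hre fun h0 => hne ?_, e⟩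
  rw [e, ← h0, Complex.ofReal_zero]

theorem PM.val_sq (σ : PM) : σ.val ^ 2 = 1 := by
  cases σ <;> simp [PM.val]

theorem PM.exists_real (σ : PM) (r : ℝ) : ∃ q : ℝ, σ.val * r = q := by
  cases σ
  · exact ⟨r, by simp [PM.val]⟩
  · exact ⟨-r, by simp [PM.val]⟩

theorem Admissible.exists_Gamma {z z' : ℂ} (hz : Admissible z z') (σ : PM) :
    ∃ γ : ℝ, 0 < γ ∧ Complex.Gamma (1 + σ.val * z) * Complex.Gamma (1 + σ.val * z') = γ := by
  obtain ⟨t, r, -, -, hr⟩ := hz.exists_real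
  cases σ
  · simp only [PM.val, one_mul]
    exact Gamma_mul_Gamma_pos (fun k hk => (hz k hk).1) hr
  · simp only [PM.val, neg_one_mul]
    refine Gamma_mul_Gamma_pos (fun k hk => (hz k hk).2) (r := -r) ?_
    push_cast
    rw [← hr]
    ring

/-! ### Scaling limit of `ψ_±` and its fractional powers -/

/-- The function `ψ_±` of a complex argument. -/
def hypPsiC (z z' : ℂ) (ξ : ℝ) (σ : PM) (u : ℂ) : ℂ :=
  (z * z') ^ (1 / 2 : ℂ) * (ξ : ℂ) ^ (u + 1 / 2) *
    (1 - (ξ : ℂ)) ^ (σ.val * (z + z')) *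
    (Complex.Gamma (u + 1 + σ.val * z) * Complex.Gamma (u + 1 + σ.val * z')) /
    (Complex.Gamma (1 + σ.val * z) * Complex.Gamma (1 + σ.val * z') *
      Complex.Gamma (u + 1) * Complex.Gamma (u + 1))

/-- The scaling limit of `ψ_±`. -/
def limPsi (z z' : ℂ) (σ : PM) (x : ℂ) : ℂ :=
  (z * z') ^ (1 / 2 : ℂ) * Complex.exp (-x) * x ^ (σ.val * (z + z')) /
    (Complex.Gamma (1 + σ.val * z) * Complex.Gamma (1 + σ.val * z'))

theorem holLim_self_cpow (d : ℂ) (x₀ : ℂ) :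
    HolLim (𝓝[<] (1 : ℝ)) (fun ξ x => (ξ : ℂ) ^ (x / (1 - ξ) + d)) (fun x => Complex.exp (-x))
      x₀ := by
  refine ⟨?_, .of_forall fun x => ?_⟩
  · filter_upwards [(tendsto_fst (f := 𝓝[<] (1 : ℝ)) (g := 𝓝 x₀)).eventually eventually_mem_Ioo]
      with p hp
    have : (p.1 : ℂ) ≠ 0 := by exact_mod_cast hp.1.ne'
    exact DifferentiableAt.const_cpow (by fun_prop) (Or.inl this)
  · have := tendsto_one_sub_cpow d x 1
    simpa using this

/-- The power `(1-ξ)^(±(z+z'))` splits into exactly the two normalizing factors required by the two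
Gamma quotients. -/
theorem holLim_hypPsiC {z z' : ℂ} (hz : Admissible z z') (σ : PM) {x₀ : ℂ} (hx₀ : 0 < x₀.re) :
    HolLim (𝓝[<] (1 : ℝ)) (fun ξ x => hypPsiC z z' ξ σ (x / (1 - ξ))) (limPsi z z' σ) x₀ := by
  obtain ⟨γ, hγ, eγ⟩ := hz.exists_Gamma σ
  have hγ0 : (γ : ℂ) ≠ 0 := by exact_mod_cast hγ.ne'
  have h := (((HolLim.param (tendsto_const_nhds (x := (z * z') ^ (1 / 2 : ℂ) / γ))).mul
    (holLim_self_cpow (1 / 2) x₀)).mul (holLim_Gamma_div (1 + σ.val * z) 1 hx₀)).mul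
    (holLim_Gamma_div (1 + σ.val * z') 1 hx₀)
  refine h.congr ?_ ?_
  · filter_upwards [eventually_fst_lt_one] with p hp
    have h0 := one_sub_ne_zero_of_lt hp
    rw [hypPsiC, eγ, mul_add, Complex.cpow_add _ _ h0]
    simp only [add_sub_cancel_left, add_assoc]
    ring
  · filter_upwards [eventually_re_pos hx₀] with x hx
    rw [limPsi, eγ, mul_add, Complex.cpow_add _ _ (ne_zero_of_re_pos hx)]
    simp only [add_sub_cancel_left]
    ring

theorem cpow_exp_ofReal (L : ℝ) (p : ℂ) : Complex.exp (L : ℂ) ^ p = Complex.exp (L * p) := by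
  rw [Complex.cpow_def_of_ne_zero (Complex.exp_ne_zero _), ← Complex.ofReal_exp,
    ← Complex.ofReal_log (Real.exp_pos L).le, Real.log_exp]

theorem exists_exp_eq {t : ℝ} (ht : 0 < t) : ∃ L : ℝ, (t : ℂ) = Complex.exp (L : ℂ) :=
  ⟨Real.log t, by rw [← Complex.ofReal_exp, Real.exp_log ht]⟩

/-- Once all positive quantities are exponentials of reals, identities between fractional powers
become linear identities between exponents and no branch question arises. -/
theorem limPsi_eq_exp {z z' : ℂ} {σ : PM} {t r γ x A X g : ℝ} (et : z * z' = t)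
    (er : σ.val * (z + z') = r)
    (eγ : Complex.Gamma (1 + σ.val * z) * Complex.Gamma (1 + σ.val * z') = γ)
    (hA : (t : ℂ) = Complex.exp A) (hX : (x : ℂ) = Complex.exp X) (hg : (γ : ℂ) = Complex.exp g) :
    limPsi z z' σ x = Complex.exp ((A / 2 - x + r * X - g : ℝ) : ℂ) := by
  rw [limPsi, et, er, eγ, hA, hg]
  have : (x : ℂ) ^ (r : ℂ) = Complex.exp (X * r) := by rw [hX, cpow_exp_ofReal]
  rw [this, cpow_exp_ofReal, ← Complex.exp_add, ← Complex.exp_add, ← Complex.exp_sub]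
  congr 1
  push_cast
  ring

/-- Positivity of the limit makes the principal power `-1/2` holomorphic around it, so the limit
passes through that power. -/
theorem limPsi_mem_slitPlane {z z' : ℂ} (hz : Admissible z z') (σ : PM) {x : ℝ} (hx : 0 < x) :
    limPsi z z' σ x ∈ Complex.slitPlane := by
  obtain ⟨t, r, ht, et, er⟩ := hz.exists_real
  obtain ⟨q, hq⟩ := σ.exists_real r
  rw [← er] at hq
  obtain ⟨γ, hγ, eγ⟩ := hz.exists_Gamma σ
  obtain ⟨A, hA⟩ := exists_exp_eq ht
  obtain ⟨X, hX⟩ := exists_exp_eq hx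
  obtain ⟨g, hg⟩ := exists_exp_eq hγ
  rw [limPsi_eq_exp et hq eγ hA hX hg, ← Complex.ofReal_exp]
  exact Complex.ofReal_mem_slitPlane.2 (Real.exp_pos _)

theorem calP_prefactor {z z' : ℂ} (hz : Admissible z z') (σ : PM) {x : ℝ} (hx : 0 < x) :
    limPsi z z' σ x ^ (-1 / 2 : ℂ) * limPsi z z' σ x =
      (z * z') ^ (1 / 4 : ℂ) /
        (Complex.Gamma (1 + σ.val * z) * Complex.Gamma (1 + σ.val * z') * (x : ℂ)) ^ (1 / 2 : ℂ) *
        ((x : ℂ) ^ ((σ.val * (z + z') + 1) / 2) * Complex.exp (-(x : ℂ) / 2)) ∧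
    limPsi z z' σ x ^ (-1 / 2 : ℂ) * ((z * z') ^ (1 / 2 : ℂ) * limPsi z z' σ x / x) =
      (z * z') ^ (3 / 4 : ℂ) /
        (Complex.Gamma (1 + σ.val * z) * Complex.Gamma (1 + σ.val * z') * (x : ℂ)) ^ (1 / 2 : ℂ) *
        ((x : ℂ) ^ ((σ.val * (z + z') - 1) / 2) * Complex.exp (-(x : ℂ) / 2)) := by
  obtain ⟨t, r, ht, et, er⟩ := hz.exists_real
  obtain ⟨q, hq⟩ := σ.exists_real r
  rw [← er] at hq
  obtain ⟨γ, hγ, eγ⟩ := hz.exists_Gamma σ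
  obtain ⟨A, hA⟩ := exists_exp_eq ht
  obtain ⟨X, hX⟩ := exists_exp_eq hx
  obtain ⟨g, hg⟩ := exists_exp_eq hγ
  have hgX : (γ : ℂ) * x = Complex.exp ((g + X : ℝ) : ℂ) := by
    rw [hg, hX, ← Complex.exp_add]; push_cast; rfl
  have hXp : ∀ p : ℂ, (x : ℂ) ^ p = Complex.exp (X * p) := fun p => by rw [hX, cpow_exp_ofReal]
  have hXd : ∀ y : ℂ, y / (x : ℂ) = y / Complex.exp X := fun y => by rw [hX]
  rw [limPsi_eq_exp et hq eγ hA hX hg, et, hq, eγ, hgX, hXp, hXp, hXd, hA]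
  simp only [cpow_exp_ofReal, ← Complex.exp_add, ← Complex.exp_sub]
  constructor <;>
  · congr 1
    push_cast
    ring

/-! ### From complex limits to lattice points and kernels -/

/-- The functions `p ξ` of a real variable have the scaling limit `q`, together with their
derivatives. -/
def ScalingLimit (p : ℝ → ℝ → ℂ) (q : ℝ → ℂ) : Prop :=
  ∀ u : ℝ, 0 < u →
    Tendsto (fun ξ : ℝ => p ξ ⌊u / (1 - ξ)⌋₊) (𝓝[<] 1) (𝓝 (q u)) ∧
    Tendsto (fun ξ : ℝ => 1 / (1 - (ξ : ℂ)) * deriv (p ξ) ⌊u / (1 - ξ)⌋₊) (𝓝[<] 1)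
      (𝓝 (deriv q u))

theorem tendsto_floor {u : ℝ} (hu : 0 < u) :
    Tendsto (fun ξ : ℝ => (1 - ξ) * (⌊u / (1 - ξ)⌋₊ : ℝ)) (𝓝[<] 1) (𝓝 u) := by
  have h0 : Tendsto (fun ξ : ℝ => (1 - ξ)⁻¹) (𝓝[<] 1) atTop := by
    refine tendsto_inv_nhdsGT_zero.comp (tendsto_nhdsWithin_iff.2 ⟨?_, ?_⟩)
    · have h1 : ContinuousAt (fun ξ : ℝ => 1 - ξ) 1 := by fun_prop
      have := h1.tendsto.mono_left (nhdsWithin_le_nhds (s := Iio (1 : ℝ)))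
      simpa using this
    · filter_upwards [self_mem_nhdsWithin] with ξ hξ
      exact sub_pos.2 (show ξ < 1 from hξ)
  refine ((tendsto_nat_floor_mul_div_atTop hu.le).comp h0).congr fun ξ => ?_
  simp only [Function.comp, div_eq_mul_inv, inv_inv]
  ring

/-- Joint convergence may be evaluated along `x = (1-ξ)⌊u/(1-ξ)⌋ → u`; the chain rule for `u ↦
(1-ξ)u` accounts for the factor `1/(1-ξ)` on derivatives. -/
theorem ScalingLimit.of_holLim {p : ℝ → ℝ → ℂ} {q : ℝ → ℂ} {φ : ℝ → ℂ → ℂ} {g : ℂ → ℂ}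
    (h : ∀ x : ℝ, 0 < x → HolLim (𝓝[<] (1 : ℝ)) φ g x)
    (hp : ∀ ξ < 1, ∀ u : ℝ, p ξ u = φ ξ ((1 - ξ) * u))
    (hq : ∀ x : ℝ, 0 < x → q x = g x) : ScalingLimit p q := by
  intro u hu
  have hH := h u hu
  have hx : Tendsto (fun ξ : ℝ => (ξ, (1 - (ξ : ℂ)) * ((⌊u / (1 - ξ)⌋₊ : ℝ) : ℂ))) (𝓝[<] 1)
      (𝓝[<] (1 : ℝ) ×ˢ 𝓝 (u : ℂ)) := by
    refine tendsto_id.prodMk ?_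
    have := (Complex.continuous_ofReal.tendsto u).comp (tendsto_floor hu)
    refine this.congr fun ξ => ?_
    simp only [Function.comp]
    push_cast
    rfl
  constructor
  · rw [hq u hu]
    refine (hH.tendsto.comp hx).congr' ?_
    filter_upwards [self_mem_nhdsWithin] with ξ hξ
    exact (hp ξ hξ _).symm
  · have hd : deriv q u = deriv g u := by
      refine HasDerivAt.deriv ?_
      refine (hH.differentiableAt.hasDerivAt.comp_ofReal).congr_of_eventuallyEq ?_
      filter_upwards [lt_mem_nhds hu] with x hx using hq x hx
    rw [hd]
    refine (hH.tendsto_deriv.comp hx).congr' ?_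
    filter_upwards [self_mem_nhdsWithin, hx.eventually hH.1] with ξ hξ hdiff
    have h0 := one_sub_ne_zero_of_lt hξ
    have h1 : HasDerivAt (fun v : ℂ => (1 - (ξ : ℂ)) * v) (1 - ξ) ((⌊u / (1 - ξ)⌋₊ : ℝ) : ℂ) := by
      simpa using (hasDerivAt_id ((⌊u / (1 - ξ)⌋₊ : ℝ) : ℂ)).const_mul (1 - (ξ : ℂ))
    have h2 := (HasDerivAt.comp _ hdiff.hasDerivAt h1).comp_ofReal
    have h3 : p ξ = fun v : ℝ => (φ ξ ∘ fun v : ℂ => (1 - (ξ : ℂ)) * v) (v : ℂ) :=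
      funext fun v => hp ξ hξ v
    rw [h3, h2.deriv]
    simp only [Function.comp]
    field_simp

/-- The two cases of the definition match: for `u = v` the integer parts coincide, and for `u ≠ v`
they eventually differ, as their rescaled difference tends to `u - v`. -/
theorem ScalingLimit.wronskianQuot {P Q : ℝ → ℝ → ℂ} {p q : ℝ → ℂ} (hP : ScalingLimit P p)
    (hQ : ScalingLimit Q q) {u v : ℝ} (hu : 0 < u) (hv : 0 < v) :
    Tendsto (fun ξ : ℝ => 1 / (1 - (ξ : ℂ)) *
      wronskianQuot (P ξ) (Q ξ) ⌊u / (1 - ξ)⌋₊ ⌊v / (1 - ξ)⌋₊) (𝓝[<] 1)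
      (𝓝 (wronskianQuot p q u v)) := by
  by_cases huv : u = v
  · subst huv
    simp only [_root_.wronskianQuot, if_true]
    refine (((hP u hu).2.mul (hQ u hu).1).sub ((hQ u hu).2.mul (hP u hu).1)).congr fun ξ => ?_
    ring
  · have hd := (tendsto_floor hu).sub (tendsto_floor hv)
    have hd' := (Complex.continuous_ofReal.tendsto _).comp hd
    have hne : ((u - v : ℝ) : ℂ) ≠ 0 := by exact_mod_cast sub_ne_zero.2 huv
    have h := ((((hP u hu).1.mul (hQ v hv).1).sub ((hQ u hu).1.mul (hP v hv).1)).div hd' hne)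
    rw [_root_.wronskianQuot, if_neg huv]
    rw [Complex.ofReal_sub] at h
    refine h.congr' ?_
    filter_upwards [hd.eventually_ne (sub_ne_zero.2 huv), self_mem_nhdsWithin] with ξ h1 h2
    have h3 : (⌊u / (1 - ξ)⌋₊ : ℝ) ≠ ⌊v / (1 - ξ)⌋₊ := fun h => h1 (by rw [h, sub_self])
    rw [_root_.wronskianQuot, if_neg h3]
    simp only [Pi.div_apply, Function.comp]
    push_cast
    rw [← mul_sub, div_mul_div_comm, one_mul]

theorem ScalingLimit.sum_quot {P Q P' Q' : ℝ → ℝ → ℂ} {p q p' q' : ℝ → ℂ} (hP : ScalingLimit P p)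
    (hQ : ScalingLimit Q q) (hP' : ScalingLimit P' p') (hQ' : ScalingLimit Q' q')
    {u v : ℝ} (hu : 0 < u) (hv : 0 < v) :
    Tendsto (fun ξ : ℝ => 1 / (1 - (ξ : ℂ)) *
      ((P ξ ⌊u / (1 - ξ)⌋₊ * P' ξ ⌊v / (1 - ξ)⌋₊ + Q ξ ⌊u / (1 - ξ)⌋₊ * Q' ξ ⌊v / (1 - ξ)⌋₊) /
        ((⌊u / (1 - ξ)⌋₊ : ℂ) + (⌊v / (1 - ξ)⌋₊ : ℂ) + 1))) (𝓝[<] 1)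
      (𝓝 ((p u * p' v + q u * q' v) / ((u : ℂ) + (v : ℂ)))) := by
  have h1 : Tendsto (fun ξ : ℝ => 1 - ξ) (𝓝[<] 1) (𝓝 0) := by
    have h1 : ContinuousAt (fun ξ : ℝ => 1 - ξ) 1 := by fun_prop
    have := h1.tendsto.mono_left (nhdsWithin_le_nhds (s := Iio (1 : ℝ)))
    simpa using this
  have hd := (Complex.continuous_ofReal.tendsto _).comp
    (((tendsto_floor hu).add (tendsto_floor hv)).add h1)
  have hne : ((u + v + 0 : ℝ) : ℂ) ≠ 0 := by
    rw [add_zero]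
    exact_mod_cast (add_pos hu hv).ne'
  have h := ((((hP u hu).1.mul (hP' v hv).1).add ((hQ u hu).1.mul (hQ' v hv).1)).div hd hne)
  rw [add_zero, Complex.ofReal_add] at h
  refine h.congr fun ξ => ?_
  simp only [Pi.div_apply, Function.comp]
  push_cast
  rw [div_mul_div_comm, one_mul]
  congr 1
  ring

/-! ### Limits of `P_±` and `Q_±`, and the theorem -/

theorem holLim_hypPsiC_cpow {z z' : ℂ} (hz : Admissible z z') (σ : PM) {x : ℝ} (hx : 0 < x) :
    HolLim (𝓝[<] (1 : ℝ)) (fun ξ x => hypPsiC z z' ξ σ (x / (1 - ξ)) ^ (-1 / 2 : ℂ))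
      (fun x => limPsi z z' σ x ^ (-1 / 2 : ℂ)) x := by
  refine (holLim_hypPsiC hz σ (by simpa using hx)).comp (f := fun y => y ^ (-1 / 2 : ℂ)) ?_
  filter_upwards [Complex.isOpen_slitPlane.mem_nhds (limPsi_mem_slitPlane hz σ hx)] with y hy
  exact differentiableAt_id.cpow_const hy

theorem scalingLimit_hypP {z z' : ℂ} (hz : Admissible z z') (σ : PM) :
    ScalingLimit (fun ξ => hypP z z' ξ σ) (calP z z' σ) := by
  obtain ⟨G, H, hG⟩ := exists_gaussLimitPair (-(σ.val * z)) (-(σ.val * z'))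
  refine ScalingLimit.of_holLim
    (φ := fun ξ x => hypPsiC z z' ξ σ (x / (1 - ξ)) ^ (-1 / 2 : ℂ) *
      (hypPsiC z z' ξ σ (x / (1 - ξ)) *
        gaussF (-(σ.val * z)) (-(σ.val * z')) (x / (1 - ξ) + 1) (ξ / (ξ - 1))))
    (g := fun x => limPsi z z' σ x ^ (-1 / 2 : ℂ) * (limPsi z z' σ x * G x)) ?_ ?_ ?_
  · intro x hx
    have hx' : 0 < ((x : ℂ)).re := by simpa using hx
    exact (holLim_hypPsiC_cpow hz σ hx).mul
      ((holLim_hypPsiC hz σ hx').mul (hG.left.holLim 1 x hx'))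
  · intro ξ hξ u
    simp only [mul_div_cancel_left₀ _ (one_sub_ne_zero_of_lt hξ)]
    rfl
  · intro x hx
    -- Here `(b - a)/2 = ±(z - z')/2`; the sign disappears on squaring.
    have hW := hG.isWhittaker (κ := (σ.val * (z + z') + 1) / 2) (μ := (z - z') / 2) (by ring) (by
      linear_combination (-((z - z') / 2) ^ 2) * σ.val_sq)
    rw [calP, hW.whittakerW_eq hx]
    linear_combination (-(G x)) * (calP_prefactor hz σ hx).1

theorem scalingLimit_hypQ {z z' : ℂ} (hz : Admissible z z') (σ : PM) :
    ScalingLimit (fun ξ => hypQ z z' ξ σ) (calQ z z' σ) := by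
  obtain ⟨G, H, hG⟩ := exists_gaussLimitPair (1 - σ.val * z) (1 - σ.val * z')
  refine ScalingLimit.of_holLim
    (φ := fun ξ x => hypPsiC z z' ξ σ (x / (1 - ξ)) ^ (-1 / 2 : ℂ) *
      ((z * z') ^ (1 / 2 : ℂ) * (ξ : ℂ) ^ (1 / 2 : ℂ) * hypPsiC z z' ξ σ (x / (1 - ξ)) / (1 - ξ) *
        (gaussF (1 - σ.val * z) (1 - σ.val * z') (x / (1 - ξ) + 2) (ξ / (ξ - 1)) /
          (x / (1 - ξ) + 1))))
    (g := fun x => limPsi z z' σ x ^ (-1 / 2 : ℂ) *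
      ((z * z') ^ (1 / 2 : ℂ) * limPsi z z' σ x / x * G x)) ?_ ?_ ?_
  · intro x hx
    have hx' : 0 < ((x : ℂ)).re := by simpa using hx
    refine (holLim_hypPsiC_cpow hz σ hx).mul ?_
    have hξ : Tendsto (fun ξ : ℝ => (ξ : ℂ)) (𝓝[<] 1) (𝓝 1) := by
      have := (Complex.continuous_ofReal.tendsto 1).mono_left
        (nhdsWithin_le_nhds (s := Iio (1 : ℝ)))
      simpa using this
    have hξ' : Tendsto (fun ξ : ℝ => (z * z') ^ (1 / 2 : ℂ) * (ξ : ℂ) ^ (1 / 2 : ℂ)) (𝓝[<] 1)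
        (𝓝 ((z * z') ^ (1 / 2 : ℂ))) := by
      have := (Tendsto.comp (continuousAt_cpow_const (b := (1 / 2 : ℂ)) (by simp)).tendsto
        hξ).const_mul ((z * z') ^ (1 / 2 : ℂ))
      simpa [Function.comp_def] using this
    have hid : HolLim (𝓝[<] (1 : ℝ)) (fun _ y => y) (fun y => y) (x : ℂ) :=
      HolLim.fixed (.of_forall fun _ => differentiableAt_id)
    have hden := hid.add (HolLim.param (hξ.const_sub 1))
    simp only [sub_self, add_zero] at hden
    have h := (((HolLim.param hξ').mul (holLim_hypPsiC hz σ hx')).div hden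
      (ne_zero_of_re_pos hx')).mul (hG.left.holLim 2 x hx')
    refine h.congr ?_ .rfl
    filter_upwards [eventually_fst_lt_one] with p hp
    have h0 := one_sub_ne_zero_of_lt hp
    -- The prefactor `1/(1-ξ)` combines with `1/(u+1)`: their denominators multiply to `x + (1-ξ)`,
    -- which tends to `x`.
    have hx : p.2 + (1 - (p.1 : ℂ)) = (1 - p.1) * (p.2 / (1 - p.1) + 1) := by
      field_simp
    rw [hx, div_mul_div_comm, div_mul_eq_mul_div]
  · intro ξ hξ u
    simp only [mul_div_cancel_left₀ _ (one_sub_ne_zero_of_lt hξ)]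
    rfl
  · intro x hx
    have hW := hG.isWhittaker (κ := (σ.val * (z + z') - 1) / 2) (μ := (z - z') / 2) (by ring) (by
      linear_combination (-((z - z') / 2) ^ 2) * σ.val_sq)
    rw [calQ, hW.whittakerW_eq hx]
    linear_combination (-(G x)) * (calP_prefactor hz σ hx).2

end

theorem theorem5p4 (z z' : ℂ) (hz : Admissible z z') (σ τ : PM) (u v : ℝ)
    (hu : 0 < u) (hv : 0 < v) :
    Tendsto
      (fun ξ : ℝ => (1 / (1 - (ξ : ℂ))) *
        hypergeometricKernel z z' ξ σ τ ⌊u / (1 - ξ)⌋₊ ⌊v / (1 - ξ)⌋₊)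
      (𝓝[<] (1 : ℝ)) (𝓝 (whittakerKernel z z' σ τ u v)) := by
  have hP := scalingLimit_hypP hz
  have hQ := scalingLimit_hypQ hz
  cases σ <;> cases τ <;> simp only [hypergeometricKernel, whittakerKernel]
  · exact (hP .plus).wronskianQuot (hQ .plus) hu hv
  · exact (hP .plus).sum_quot (hQ .plus) (hP .minus) (hQ .minus) hu hv
  · simp only [mul_neg]
    exact ((hP .minus).sum_quot (hQ .minus) (hP .plus) (hQ .plus) hu hv).neg
  · exact (hP .minus).wronskianQuot (hQ .minus) hu hv
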